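/- Let $d\ge 2$ and let $w_1\ge w_2\ge\cdots\ge w_d>0$ with $w_1+\cdots+w_d=1$. Put $\mathsf p_n:=w_1^n+\cdots+w_d^n$. Let $S_\infty$ be the group of finite permutations of $\mathbb N=\{1,2,\dots\}$, let $\gamma_n:=(1,n+1)\in S_\infty$ for $n\ge1$, and let $\chi:S_\infty\to\mathbb R$, $\chi(\sigma):=\prod_{V}\mathsf p_{|V|}$, the product being over the orbits $V$ of $\sigma$ with $|V|\ge2$ (the empty product is $1$). Let $U:S_\infty\to B(\mathcal H)$ be the GNS representation of $\chi$: $\mathcal H$ is a complex Hilbert space with vectors $\widehat\sigma$ ($\sigma\in S_\infty$) whose linear span is dense and which satisfy $\langle\widehat\sigma,\widehat\tau\rangle=\chi(\sigma\tau^{-1})$, and $U(\sigma)\widehat\tau=\widehat{\sigma\tau}$. Let $A_0$ be the limit of $\frac1n\sum_{i=1}^nU(\gamma_i)$ in the strong operator topology as $n\to\infty$. Let $\mu_n$ be the law of $\frac1{\sqrt n}\sum_{i=1}^n(U(\gamma_i)-A_0)$ with respect to the vector state $T\mapsto\langle T\widehat e,\widehat e\rangle$, where $e$ is the unit of $S_\infty$;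 that is, $\mu_n$ is the compactly supported probability measure on $\mathbb R$ whose moments are those of this operator in this state. Let $\mu_{\underline w}$ be the weak limit of the probability measures $\mu_n$ as $n\to\infty$. For $k\ge1$ let $\mathcal P_{\le2}(k)$ be the set of partitions of $\{1,\dots,k\}$ all of whose blocks have one or two elements, and for $\pi\in\mathcal P_{\le2}(k)$ let $|\pi|_1$ be the number of its one-element blocks (which has the parity of $k$). List the blocks $V_1,\dots,V_\ell$ of $\pi$ in decreasing order of their maximal elements, let $r(h):=i$ for $h\in V_i$, and put $\tau_\pi:=\gamma_{r(1)}\gamma_{r(2)}\cdots\gamma_{r(k)}\in S_\infty$. Then the limit law $\mu_{\underline w}$ is well defined (all the objects above exist, and $\mu_{\underline w}$ is uniquely determined by $w_1,\dots,w_d$), and for every even positive integer $k$ the function $t^k$ is $\mu_{\underline w}$-integrable and $$\int_{\mathbb R}t^k\,d\mu_{\underline w}(t)=\sum_{\pi\in\mathcal P_{\le2}(k)}(-1)^{|\pi|_1/2}\,(|\pi|_1-1)!!\;\chi(\tau_\pi),$$ with the convention $(-1)!!=1$. -/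

import Mathlib

open MeasureTheory Filter Topology

namespace StarCLT

/-- The group `S_∞` of finite permutations of the positive integers.  The positive integer `m`
is represented by the natural number `m - 1`, so the distinguished point `1` becomes `0`. -/
def SInf : Subgroup (Equiv.Perm ℕ) where
  carrier := {σ | {n | σ n ≠ n}.Finite}
  one_mem' := by simp
  mul_mem' := by
    intro a b ha hb
    refine (Set.Finite.union ha hb).subset ?_
    intro n hn
    by_contra h
    simp only [Set.mem_union, Set.mem_ofPred_eq, not_or, not_not] at h
    exact hn (by rw [Equiv.Perm.mul_apply, h.2, h.1])
  inv_mem' := by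
    intro a ha
    refine Set.Finite.subset ha ?_
    intro n hn h
    exact hn (by rw [Equiv.Perm.inv_eq_iff_eq]; exact h.symm)

/-- The star-transposition `γ_n = (1, n+1)`, for `n ≥ 1`. -/
def starTransposition (n : ℕ) : SInf :=
  ⟨Equiv.swap 0 n, (Set.toFinite ({0, n} : Set ℕ)).subset (by
    intro m hm
    by_contra h
    simp only [Set.mem_insert_iff, Set.mem_singleton_iff, not_or] at h
    exact hm (Equiv.swap_apply_of_ne_of_ne h.1 h.2))⟩

/-- The power sum `p_n = w_1^n + ⋯ + w_d^n`. -/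
def powerSum {d : ℕ} (w : Fin d → ℝ) (n : ℕ) : ℝ := ∑ i, w i ^ n

/-- The orbits of `σ` that have at least two elements. -/
def nontrivialOrbits (σ : SInf) : Set (Set ℕ) :=
  {V | (∃ x, V = {y | (σ : Equiv.Perm ℕ).SameCycle x y}) ∧ 2 ≤ V.ncard}

/-- The character `χ` of `S_∞`: the product of `p_{|V|}` over the orbits `V` of `σ` with
`|V| ≥ 2`. -/
noncomputable def character {d : ℕ} (w : Fin d → ℝ) (σ : SInf) : ℝ :=
  ∏ᶠ V ∈ nontrivialOrbits σ, powerSum w V.ncard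

/-- A realization of the GNS representation of `χ` on the Hilbert space `H`: vectors `σ̂`
with dense linear span and with `⟨σ̂, τ̂⟩ = χ(σ τ⁻¹)`, and bounded operators `U(σ)` with
`U(σ) τ̂ = (στ)^`.  It is unique up to unitary equivalence.  (Mathlib's inner product is linear
in its second argument.) -/
structure GNSRep {d : ℕ} (w : Fin d → ℝ) (H : Type*) [NormedAddCommGroup H]
    [InnerProductSpace ℂ H] where
  vec : SInf → H
  dense_span : Dense (Submodule.span ℂ (Set.range vec) : Set H)
  inner_vec : ∀ σ τ, inner ℂ (vec τ) (vec σ) = (character w (σ * τ⁻¹) : ℂ)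
  U : SInf → H →L[ℂ] H
  U_vec : ∀ σ τ, U σ (vec τ) = vec (σ * τ)

section

variable {d : ℕ} {w : Fin d → ℝ} {H : Type*} [NormedAddCommGroup H] [InnerProductSpace ℂ H]

/-- `A₀` is the limit, in the strong operator topology, of the averages
`(U(γ_1) + ⋯ + U(γ_n)) / n`. -/
def GNSRep.IsAverageLimit (G : GNSRep w H) (A₀ : H →L[ℂ] H) : Prop :=
  ∀ ξ : H, Tendsto
    (fun n : ℕ => ((n : ℂ)⁻¹ • ∑ i ∈ Finset.Icc 1 n, G.U (starTransposition i)) ξ)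
    atTop (𝓝 (A₀ ξ))

/-- The rescaled average `s_n = n^{-1/2} ∑_{i=1}^n (U(γ_i) - A₀)`. -/
noncomputable def GNSRep.rescaledAverage (G : GNSRep w H) (A₀ : H →L[ℂ] H) (n : ℕ) :
    H →L[ℂ] H :=
  ((Real.sqrt n : ℝ) : ℂ)⁻¹ • ∑ i ∈ Finset.Icc 1 n, (G.U (starTransposition i) - A₀)

/-- `μ` is the law of the operator `T` with respect to the vector state `T ↦ ⟨T ξ, ξ⟩`: the
(unique) compactly supported probability measure on `ℝ` whose moments are `⟨T^m ξ, ξ⟩`. -/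
def IsLaw (T : H →L[ℂ] H) (ξ : H) (μ : ProbabilityMeasure ℝ) : Prop :=
  (∃ R : ℝ, ∀ᵐ t ∂(μ : Measure ℝ), |t| ≤ R) ∧
    ∀ m : ℕ, ((∫ t, t ^ m ∂(μ : Measure ℝ) : ℝ) : ℂ) = inner ℂ ξ ((T ^ m) ξ)

end

/-- `μ` is the limit law `μ_w` of the central limit theorem: the weak limit, as `n → ∞`, of the
laws `μ_n` of `n^{-1/2} ∑_{i=1}^n (U(γ_i) - A₀)` with respect to the vector state given by the
vector of the unit of `S_∞`, in the GNS representation of `χ`. -/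
def IsLimitLaw {d : ℕ} (w : Fin d → ℝ) (μ : ProbabilityMeasure ℝ) : Prop :=
  ∃ (H : Type) (_ : NormedAddCommGroup H) (_ : InnerProductSpace ℂ H) (_ : CompleteSpace H)
    (G : GNSRep w H) (A₀ : H →L[ℂ] H) (ν : ℕ → ProbabilityMeasure ℝ),
    G.IsAverageLimit A₀ ∧
    (∀ n, 1 ≤ n → IsLaw (G.rescaledAverage A₀ n) (G.vec 1) (ν n)) ∧
    Tendsto ν atTop (𝓝 μ)

/-- Partitions of the set `{1, …, k}`. -/
abbrev SetPartition (k : ℕ) := Finpartition (Finset.univ : Finset (Fin k))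

/-- `P_{≤2}(k)`: the partitions all of whose blocks have one or two elements. -/
def partitionsLeTwo (k : ℕ) : Finset (SetPartition k) :=
  {π | ∀ V ∈ π.parts, V.card = 1 ∨ V.card = 2}

/-- `|π|_1`, the number of singleton blocks. -/
def numSingletons {k : ℕ} (π : SetPartition k) : ℕ :=
  (π.parts.filter (fun V => V.card = 1)).card

/-- When the blocks `V_1, …, V_ℓ` of `π` are listed in decreasing order of their maximal
elements, this is the `i ∈ {1, …, ℓ}` with `h ∈ V_i`, i.e. the number of blocks whose maximum is
at least the maximum of the block of `h`. -/
def blockRank {k : ℕ} (π : SetPartition k) (h : Fin k) : ℕ :=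
  (π.parts.filter (fun V => (π.part h).max ≤ V.max)).card

/-- The permutation `τ_π = γ_{r(1)} ⋯ γ_{r(k)}`, where `r(h)` is the rank of the block of `h`. -/
def tau {k : ℕ} (π : SetPartition k) : SInf :=
  (List.ofFn (fun h : Fin k => starTransposition (blockRank π h))).prod

end StarCLT

namespace StarCLT

/-! The `k`-th moment of the rescaled sum is `n^(-k/2)` times the sum, over tuples `f` in `{1, …,
n}^k`, of the expectations of `(U(γ_{f(1)}) - A₀) ⋯ (U(γ_{f(k)}) - A₀)`. As `χ` is invariant under
conjugation by permutations fixing the distinguished point, such an expectation depends only on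
which entries of `f` coincide. Since `A₀` averages the `U(γ_i)` and almost every `i` is new to a
given word, `A₀` acts inside an expectation like a star-transposition with a fresh index
(`inner_prod_letterOp`). The expectation is thus an alternating sum over the sets `S` of positions
receiving fresh indices (`inner_prod_centered`). It vanishes if some entry of `f` occurs only once
(`centeredMoment_eq_zero`), and counting tuples leaves only pair partitions in the limit
(`tendsto_rescaled_sum`).

The formula is then a rearrangement (`limitMoment_eq`). Freshening `S` breaks the pairs that meet
`S`, which produces a partition `π` with blocks of size at most two. Each broken pair contributes
`-1 - 1 + 1 = -1`, and the singletons of `π` can be paired up again in `(|π|_1 - 1)!!` ways.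

For the analysis, `χ(σ)` is the probability that an i.i.d. colouring is `σ`-invariant, hence `χ` is
positive definite (`character_posDef`) and the GNS representation exists. The averages converge
because the vectors involved have a two-valued Gram matrix, and the laws come from the functional
calculus and the Riesz–Markov theorem (`exists_isLaw`). Centered expectations are at most `2^k` in
absolute value, so the limit moments of order `2j` are at most `4^j (2j-1)!!`. Such moments
determine the measure (`probabilityMeasure_ext_of_moments`). Tightness then gives weak convergence
(`exists_tendsto_of_moments`), and uniqueness follows because the moments are the same in every
realization. -/

/-! ### Elementary properties of the character -/

theorem setOf_sameCycle_conj (τ σ : Equiv.Perm ℕ) (x : ℕ) :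
    {y | (τ * σ * τ⁻¹).SameCycle x y} = τ '' {y | σ.SameCycle (τ⁻¹ x) y} := by
  ext y
  simp only [Set.mem_ofPred_eq, Equiv.Perm.sameCycle_conj, Set.mem_image]
  constructor
  · intro h
    exact ⟨τ⁻¹ y, h, by simp⟩
  · rintro ⟨z, hz, rfl⟩
    simpa using hz

theorem nontrivialOrbits_conj (τ σ : SInf) :
    nontrivialOrbits (τ * σ * τ⁻¹) =
      (fun V : Set ℕ => (τ : Equiv.Perm ℕ) '' V) '' nontrivialOrbits σ := by
  ext V
  constructor
  · rintro ⟨⟨x, rfl⟩, hV⟩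
    have e : {y | ((τ * σ * τ⁻¹ : SInf) : Equiv.Perm ℕ).SameCycle x y} =
        (τ : Equiv.Perm ℕ) '' {y | (σ : Equiv.Perm ℕ).SameCycle ((τ : Equiv.Perm ℕ)⁻¹ x) y} :=
      setOf_sameCycle_conj _ _ x
    rw [e, Set.ncard_image_of_injective _ (Equiv.injective _)] at hV
    rw [e]
    exact ⟨_, ⟨⟨_, rfl⟩, hV⟩, rfl⟩
  · rintro ⟨_, ⟨⟨x, rfl⟩, hV⟩, rfl⟩
    refine ⟨⟨(τ : Equiv.Perm ℕ) x, ?_⟩, ?_⟩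
    · have := setOf_sameCycle_conj τ σ ((τ : Equiv.Perm ℕ) x)
      rw [show (τ : Equiv.Perm ℕ)⁻¹ ((τ : Equiv.Perm ℕ) x) = x from Equiv.symm_apply_apply _ _] at this
      exact this.symm
    · rwa [Set.ncard_image_of_injective _ (Equiv.injective _)]

section

variable {d : ℕ} (w : Fin d → ℝ)

theorem character_conj (τ σ : SInf) : character w (τ * σ * τ⁻¹) = character w σ := by
  unfold character
  rw [nontrivialOrbits_conj, finprod_mem_image]
  · refine finprod_mem_congr rfl fun V _ => ?_
    rw [Set.ncard_image_of_injective _ (Equiv.injective _)]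
  · exact (Set.image_injective.2 (Equiv.injective _)).injOn

theorem character_mul_comm (τ σ : SInf) : character w (τ * σ) = character w (σ * τ) := by
  rw [← character_conj w σ (τ * σ)]
  congr 1
  group

theorem character_inv (σ : SInf) : character w σ⁻¹ = character w σ := by
  unfold character nontrivialOrbits
  simp [Equiv.Perm.sameCycle_inv]

theorem character_one : character w 1 = 1 := by
  unfold character
  have : nontrivialOrbits 1 = ∅ := by
    ext V
    simp only [Set.mem_empty_iff_false, iff_false]
    rintro ⟨⟨x, rfl⟩, hV⟩
    have : {y | ((1 : SInf) : Equiv.Perm ℕ).SameCycle x y} = {x} := by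
      ext y
      simp [Equiv.Perm.sameCycle_one, eq_comm]
    rw [this, Set.ncard_singleton] at hV
    omega
  rw [this, finprod_mem_empty]

variable {w}

theorem powerSum_one (hw_sum : ∑ i, w i = 1) : powerSum w 1 = 1 := by
  simpa [powerSum] using hw_sum

theorem powerSum_mem (hw_pos : ∀ i, 0 < w i) (hw_sum : ∑ i, w i = 1) {n : ℕ} (hn : n ≠ 0) :
    0 ≤ powerSum w n ∧ powerSum w n ≤ 1 := by
  refine ⟨Finset.sum_nonneg fun i _ => pow_nonneg (hw_pos i).le _, ?_⟩
  rw [← hw_sum]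
  refine Finset.sum_le_sum fun i _ => ?_
  refine pow_le_of_le_one (hw_pos i).le ?_ hn
  rw [← hw_sum]
  exact Finset.single_le_sum (f := w) (fun j _ => (hw_pos j).le) (Finset.mem_univ i)

theorem abs_character_le_one (hw_pos : ∀ i, 0 < w i) (hw_sum : ∑ i, w i = 1) (σ : SInf) :
    |character w σ| ≤ 1 := by
  have : 0 ≤ character w σ ∧ character w σ ≤ 1 := by
    unfold character
    refine finprod_mem_induction (fun x : ℝ => 0 ≤ x ∧ x ≤ 1) (by simp) ?_ ?_
    · rintro x y ⟨hx, hx'⟩ ⟨hy, hy'⟩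
      exact ⟨mul_nonneg hx hy, mul_le_one₀ hx' hy hy'⟩
    · rintro V ⟨-, hV⟩
      exact powerSum_mem hw_pos hw_sum (by omega)
  rw [abs_le]
  constructor <;> linarith [this.1, this.2]

end

/-! ### Positive definiteness via random colourings -/

/-- Every element of `S_∞` fixes all large points. -/
theorem exists_fixed_ge (σ : SInf) : ∃ N, ∀ x, N ≤ x → (σ : Equiv.Perm ℕ) x = x := by
  obtain ⟨M, hM⟩ := (show {n | (σ : Equiv.Perm ℕ) n ≠ n}.Finite from σ.2).bddAbove
  refine ⟨M + 1, fun x hx => ?_⟩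
  by_contra h
  have := hM h
  omega

/-- A colouring of `{0, …, N - 1}`, extended to `ℕ` by the colour `none`. -/
def extendColoring {d N : ℕ} (c : Fin N → Fin d) (x : ℕ) : Option (Fin d) :=
  if h : x < N then some (c ⟨x, h⟩) else none

section

variable {d N : ℕ} {σ : Equiv.Perm ℕ}

theorem apply_lt_of_fixed_ge (hσ : ∀ x, N ≤ x → σ x = x) {x : ℕ} (hx : x < N) : σ x < N := by
  by_contra h
  have := σ.injective (hσ _ (not_lt.1 h))
  omega

theorem lt_of_sameCycle (hσ : ∀ x, N ≤ x → σ x = x) {x y : ℕ} (hx : x < N)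
    (h : σ.SameCycle x y) : y < N := by
  by_contra hy
  have := h.symm.eq_of_left (hσ y (not_lt.1 hy))
  omega

theorem extendColoring_comp_eq_iff (hσ : ∀ x, N ≤ x → σ x = x) (c : Fin N → Fin d) :
    extendColoring c ∘ σ = extendColoring c ↔
      ∀ x y : Fin N, σ.SameCycle x y → c x = c y := by
  constructor
  · intro h x y ⟨i, hi⟩
    have h1 : ∀ z, extendColoring c (σ z) = extendColoring c z := fun z => congrFun h z
    have h2 : ∀ (i : ℤ) (z : ℕ), extendColoring c ((σ ^ i) z) = extendColoring c z := by
      intro i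
      induction i using Int.induction_on with
      | zero => simp
      | succ n ih =>
        intro z
        rw [zpow_add_one, Equiv.Perm.mul_apply, ih, h1]
      | pred n ih =>
        intro z
        rw [zpow_sub_one, Equiv.Perm.mul_apply, ih, ← h1 (σ⁻¹ z)]
        simp
    have h3 := h2 i x
    rw [hi] at h3
    simpa [extendColoring, eq_comm] using h3
  · intro h
    funext x
    by_cases hx : x < N
    · have hx' := apply_lt_of_fixed_ge hσ hx
      simp only [Function.comp_apply, extendColoring, hx, hx', dif_pos]
      rw [h ⟨x, hx⟩ ⟨σ x, hx'⟩ ⟨1, by simp⟩]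
    · simp [hσ x (not_lt.1 hx)]

end

section

variable {d : ℕ} {w : Fin d → ℝ}

open Classical in
/-- The character as the probability that an i.i.d. random colouring is invariant. -/
theorem character_eq_sum_coloring (hw_sum : ∑ i, w i = 1) (N : ℕ) (σ : SInf)
    (hσ : ∀ x, N ≤ x → (σ : Equiv.Perm ℕ) x = x) :
    character w σ = ∑ c : Fin N → Fin d,
      if extendColoring c ∘ (σ : Equiv.Perm ℕ) = extendColoring c then ∏ x, w (c x) else 0 := by
  let s : Setoid (Fin N) :=
    (Equiv.Perm.SameCycle.setoid (σ : Equiv.Perm ℕ)).comap (fun x : Fin N => (x : ℕ))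
  have hs : ∀ x y : Fin N, s.r x y ↔ (σ : Equiv.Perm ℕ).SameCycle x y := fun x y => Iff.rfl
  let fib : Quotient s → Finset (Fin N) := fun q => Finset.univ.filter fun x => Quotient.mk s x = q
  let O : Quotient s → Set ℕ := fun q => (fun x : Fin N => (x : ℕ)) '' (fib q : Set (Fin N))
  have hO : ∀ x : Fin N, O (Quotient.mk s x) = {y | (σ : Equiv.Perm ℕ).SameCycle x y} := by
    intro x
    ext y
    simp only [O, fib, Finset.coe_filter, Finset.mem_univ, true_and, Set.mem_image,
      Set.mem_ofPred_eq]
    constructor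
    · rintro ⟨z, hz, rfl⟩
      exact ((hs z x).1 (Quotient.exact hz)).symm
    · intro h
      exact ⟨⟨y, lt_of_sameCycle hσ x.2 h⟩, Quotient.sound ((hs _ _).2 h.symm), rfl⟩
  have hcard : ∀ q, (O q).ncard = (fib q).card := by
    intro q
    rw [Set.ncard_image_of_injective _ Fin.val_injective, Set.ncard_coe_finset]
  have hpos : ∀ q, (fib q).card ≠ 0 := by
    intro q
    induction q using Quotient.inductionOn with
    | h x => exact Finset.card_ne_zero_of_mem (a := x) (by simp [fib])
  have hOinj : Function.Injective O := by
    intro p q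
    induction p using Quotient.inductionOn with
    | h x =>
      induction q using Quotient.inductionOn with
      | h y =>
        intro h
        rw [hO, hO] at h
        have : (y : ℕ) ∈ {z | (σ : Equiv.Perm ℕ).SameCycle x z} := by
          rw [h]; exact Equiv.Perm.SameCycle.refl _ _
        exact Quotient.sound ((hs _ _).2 this)
  have h1 : character w σ = ∏ q : Quotient s, powerSum w (fib q).card := by
    have : character w σ = ∏ᶠ V ∈ Set.range O, powerSum w V.ncard := by
      -- One-point orbits below `N` occur only on the right; they carry the factor `p_1 = 1` and lie
      -- outside the multiplicative support.
      refine finprod_mem_inter_mulSupport_eq' _ _ _ fun V hV => ?_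
      constructor
      · rintro ⟨⟨x, rfl⟩, h⟩
        by_cases hx : x < N
        · exact ⟨Quotient.mk s ⟨x, hx⟩, hO _⟩
        · have : {y | (σ : Equiv.Perm ℕ).SameCycle x y} = {x} := by
            ext y
            constructor
            · intro hy
              exact (Equiv.Perm.SameCycle.eq_of_left hy (hσ x (not_lt.1 hx))).symm
            · rintro rfl
              exact Equiv.Perm.SameCycle.refl _ _
          rw [this, Set.ncard_singleton] at h
          omega
      · rintro ⟨q, rfl⟩
        induction q using Quotient.inductionOn with
        | h x =>
          refine ⟨⟨x, hO x⟩, ?_⟩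
          have h2 : powerSum w (O (Quotient.mk s x)).ncard ≠ 1 := hV
          have h3 := hpos (Quotient.mk s x)
          rw [← hcard] at h3
          have h4 : (O (Quotient.mk s x)).ncard ≠ 1 := by
            intro h
            rw [h] at h2
            exact h2 (powerSum_one hw_sum)
          omega
    rw [this, finprod_mem_range hOinj, finprod_eq_prod_of_fintype]
    simp only [hcard]
  rw [h1, ← Finset.sum_filter]
  simp only [powerSum]
  -- Expanding the product of power sums amounts to choosing a colour for each orbit, that is, an
  -- invariant colouring.
  rw [Finset.prod_univ_sum, Fintype.piFinset_univ]
  refine Finset.sum_bij (fun g _ => fun x => g (Quotient.mk s x)) ?_ ?_ ?_ ?_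
  · intro g _
    simp only [Finset.mem_filter, Finset.mem_univ, true_and]
    rw [extendColoring_comp_eq_iff hσ]
    intro x y h
    rw [Quotient.sound (show x ≈ y from h)]
  · intro g _ g' _ h
    funext q
    induction q using Quotient.inductionOn with
    | h x => exact congrFun h x
  · intro c hc
    simp only [Finset.mem_filter, Finset.mem_univ, true_and] at hc
    rw [extendColoring_comp_eq_iff hσ] at hc
    exact ⟨Quotient.lift c hc, Finset.mem_univ _, rfl⟩
  · intro g _
    rw [← Finset.prod_fiberwise (s := Finset.univ) (g := fun x => Quotient.mk s x)]
    refine Finset.prod_congr rfl fun q _ => ?_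
    rw [Finset.prod_congr rfl (g := fun _ => w (g q)), Finset.prod_const]
    intro x hx
    exact congrArg (fun p => w (g p)) (Finset.mem_filter.1 hx).2

open Classical in
-- Grouping by the value of `b` turns the form into a sum of squared moduli of the fibre sums of
-- `z`.
theorem re_sum_indicator_nonneg {ι β : Type*} (s : Finset ι) (b : ι → β) (z : ι → ℂ) :
    0 ≤ (∑ x ∈ s, ∑ y ∈ s, if b y = b x then star (z x) * z y else 0 : ℂ).re := by
  have : (∑ x ∈ s, ∑ y ∈ s, if b y = b x then star (z x) * z y else 0 : ℂ) =
      ∑ β ∈ s.image b, star (∑ x ∈ s with b x = β, z x) * (∑ x ∈ s with b x = β, z x) := by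
    rw [← Finset.sum_fiberwise_of_maps_to (g := b) (fun x hx => Finset.mem_image_of_mem b hx)]
    refine Finset.sum_congr rfl fun β _ => ?_
    rw [star_sum, Finset.sum_mul_sum]
    refine Finset.sum_congr rfl fun x hx => ?_
    rw [← Finset.sum_filter, (Finset.mem_filter.1 hx).2]
  rw [this, Complex.re_sum]
  refine Finset.sum_nonneg fun β _ => ?_
  rw [Complex.star_def, ← Complex.normSq_eq_conj_mul_self, Complex.ofReal_re]
  exact Complex.normSq_nonneg _

open Classical in
-- A colouring is invariant under `y * x⁻¹` exactly when its compositions with `x` and `y` agree.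
-- For each colouring this is an indicator kernel as in `re_sum_indicator_nonneg`, and the character
-- averages these kernels with nonnegative weights.
theorem character_posDef (hw_pos : ∀ i, 0 < w i) (hw_sum : ∑ i, w i = 1)
    (s : Finset SInf) (z : SInf → ℂ) :
    0 ≤ (∑ x ∈ s, ∑ y ∈ s, (character w (y * x⁻¹) : ℂ) * (star (z x) * z y)).re := by
  choose N hN using exists_fixed_ge
  let M := s.sup N
  have hM : ∀ x ∈ s, ∀ n, M ≤ n → (x : Equiv.Perm ℕ) n = n :=
    fun x hx n hn => hN x n ((Finset.le_sup hx).trans hn)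
  have key : ∀ x ∈ s, ∀ y ∈ s, (character w (y * x⁻¹) : ℂ) * (star (z x) * z y) =
      ∑ c : Fin M → Fin d, ((∏ i, w (c i) : ℝ) : ℂ) *
        (if extendColoring c ∘ (y : Equiv.Perm ℕ) = extendColoring c ∘ (x : Equiv.Perm ℕ)
          then star (z x) * z y else 0) := by
    intro x hx y hy
    rw [character_eq_sum_coloring hw_sum M, Complex.ofReal_sum, Finset.sum_mul]
    · refine Finset.sum_congr rfl fun c _ => ?_
      have : (extendColoring c ∘ ((y * x⁻¹ : SInf) : Equiv.Perm ℕ) = extendColoring c) ↔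
          extendColoring c ∘ (y : Equiv.Perm ℕ) = extendColoring c ∘ (x : Equiv.Perm ℕ) := by
        constructor
        · intro h
          funext n
          simpa using congrFun h ((x : Equiv.Perm ℕ) n)
        · intro h
          funext n
          simpa using congrFun h ((x : Equiv.Perm ℕ)⁻¹ n)
      simp only [this]
      split_ifs <;> simp
    · intro n hn
      have : (x : Equiv.Perm ℕ)⁻¹ n = n := by
        rw [Equiv.Perm.inv_eq_iff_eq]
        exact (hM x hx n hn).symm
      change (y : Equiv.Perm ℕ) ((x : Equiv.Perm ℕ)⁻¹ n) = n
      rw [this, hM y hy n hn]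
  rw [Finset.sum_congr rfl fun x hx => Finset.sum_congr rfl fun y hy => key x hx y hy]
  simp_rw [Finset.sum_comm (t := (Finset.univ : Finset (Fin M → Fin d))), ← Finset.mul_sum]
  rw [Complex.re_sum]
  refine Finset.sum_nonneg fun c _ => ?_
  rw [Complex.re_ofReal_mul]
  exact mul_nonneg (Finset.prod_nonneg fun i _ => (hw_pos _).le) (re_sum_indicator_nonneg s _ z)

end

/-! ### Operators defined by Gram matrices -/

section Gram

variable {ι E F : Type*} [NormedAddCommGroup E] [InnerProductSpace ℂ E] [NormedAddCommGroup F]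
  [InnerProductSpace ℂ F]

theorem norm_linearCombination_eq_of_gram {v : ι → E} {v' : ι → F}
    (h : ∀ i j, inner ℂ (v i) (v j) = inner ℂ (v' i) (v' j)) (l : ι →₀ ℂ) :
    ‖Finsupp.linearCombination ℂ v l‖ = ‖Finsupp.linearCombination ℂ v' l‖ := by
  rw [← sq_eq_sq₀ (norm_nonneg _) (norm_nonneg _), ← inner_self_eq_norm_sq (𝕜 := ℂ),
    ← inner_self_eq_norm_sq (𝕜 := ℂ)]
  congr 1
  simp only [Finsupp.linearCombination_apply, Finsupp.sum, sum_inner, inner_sum, inner_smul_left,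
    inner_smul_right, h]

theorem denseRange_linearCombination {v : ι → E}
    (hv : Dense (Submodule.span ℂ (Set.range v) : Set E)) :
    DenseRange (Finsupp.linearCombination ℂ v) := by
  rw [← Finsupp.range_linearCombination] at hv
  exact hv

/-- Equal Gram matrices make the assignment on the generators isometric on linear combinations, so
it extends from the dense span. -/
theorem exists_clm_of_gram [CompleteSpace E] {v v' : ι → E}
    (hv : Dense (Submodule.span ℂ (Set.range v) : Set E))
    (h : ∀ i j, inner ℂ (v i) (v j) = inner ℂ (v' i) (v' j)) :
    ∃ T : E →L[ℂ] E, ∀ i, T (v i) = v' i := by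
  refine ⟨(Finsupp.linearCombination ℂ v').extendOfNorm (Finsupp.linearCombination ℂ v),
    fun i => ?_⟩
  have := LinearMap.extendOfNorm_eq (f := Finsupp.linearCombination ℂ v')
    (e := Finsupp.linearCombination ℂ v) (denseRange_linearCombination hv)
    ⟨1, fun x => by rw [one_mul, norm_linearCombination_eq_of_gram h]⟩ (Finsupp.single i 1)
  simpa using this

end Gram

/-! ### Existence of the GNS representation -/

section

variable {d : ℕ} {w : Fin d → ℝ}

/-- The scalar-operator-valued kernel `(σ, τ) ↦ χ(τ σ⁻¹)`. -/
noncomputable def characterKernel (w : Fin d → ℝ) : Matrix SInf SInf (ℂ →L[ℂ] ℂ) :=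
  fun σ τ => (character w (τ * σ⁻¹) : ℂ) • ContinuousLinearMap.id ℂ ℂ

theorem character_mul_inv_symm (σ τ : SInf) :
    character w (σ * τ⁻¹) = character w (τ * σ⁻¹) := by
  rw [← character_inv, mul_inv_rev, inv_inv]

open scoped ComplexOrder in
theorem characterKernel_posSemidef (hw_pos : ∀ i, 0 < w i) (hw_sum : ∑ i, w i = 1) :
    (characterKernel w).PosSemidef := by
  have key := (RKHS.posSemidef_tfae (K := characterKernel w)).out 0 2
  refine key.2 ⟨?_, fun z => ?_⟩
  · ext σ τ
    simp only [Matrix.conjTranspose_apply, characterKernel, star_smul]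
    rw [character_mul_inv_symm]
    rw [show star (ContinuousLinearMap.id ℂ ℂ) = ContinuousLinearMap.id ℂ ℂ from star_one _]
    simp
  · have := character_posDef hw_pos hw_sum z.support (fun s => z s)
    convert! this using 2
    simp only [Finsupp.sum, characterKernel]
    refine Finset.sum_congr rfl fun x _ => Finset.sum_congr rfl fun y _ => ?_
    rw [character_mul_inv_symm]
    simp
    ring

open scoped ComplexOrder in
/-- The GNS representation of `χ` exists. -/
theorem exists_gnsRep (hw_pos : ∀ i, 0 < w i) (hw_sum : ∑ i, w i = 1) :
    ∃ (H : Type) (_ : NormedAddCommGroup H) (_ : InnerProductSpace ℂ H) (_ : CompleteSpace H),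
      Nonempty (GNSRep w H) := by
  have : Fact (characterKernel w).PosSemidef := ⟨characterKernel_posSemidef hw_pos hw_sum⟩
  let v : SInf → RKHS.OfKernel (characterKernel w) :=
    fun σ => RKHS.kerFun (RKHS.OfKernel (characterKernel w)) σ 1
  have hv : ∀ σ τ, inner ℂ (v τ) (v σ) = (character w (σ * τ⁻¹) : ℂ) := by
    intro σ τ
    simp only [v]
    rw [RKHS.kerFun_inner, RKHS.kerFun_apply, RKHS.OfKernel.kernel_ofKernel]
    simp [characterKernel]
  have hd : Dense (Submodule.span ℂ (Set.range v) : Set (RKHS.OfKernel (characterKernel w))) := by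
    have h := RKHS.kerFun_dense (RKHS.OfKernel (characterKernel w))
    rw [← Submodule.dense_iff_topologicalClosure_eq_top] at h
    refine h.mono ?_
    refine Submodule.span_le.2 ?_
    rintro _ ⟨x, c, rfl⟩
    have : RKHS.kerFun (RKHS.OfKernel (characterKernel w)) x c = c • v x := by
      simp only [v]
      rw [← map_smul, smul_eq_mul, mul_one]
    rw [SetLike.mem_coe, this]
    exact Submodule.smul_mem _ _ (Submodule.subset_span ⟨x, rfl⟩)
  have hU : ∀ σ : SInf, ∃ T : RKHS.OfKernel (characterKernel w) →L[ℂ]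
      RKHS.OfKernel (characterKernel w), ∀ τ, T (v τ) = v (σ * τ) := by
    intro σ
    refine exists_clm_of_gram (v' := fun τ => v (σ * τ)) hd fun τ τ' => ?_
    -- Centrality of the character is what makes left translation preserve the Gram matrix.
    rw [hv, hv, show σ * τ' * (σ * τ)⁻¹ = σ * (τ' * τ⁻¹) * σ⁻¹ by group, character_conj]
  choose U hU using hU
  exact ⟨RKHS.OfKernel (characterKernel w), inferInstance, inferInstance, inferInstance,
    ⟨⟨v, hd, hv, U, hU⟩⟩⟩

end

/-! ### Star-transpositions and relabelling -/

/-- A transposition as an element of `S_∞`. -/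
def swapSInf (a b : ℕ) : SInf :=
  ⟨Equiv.swap a b, (Set.toFinite ({a, b} : Set ℕ)).subset (by
    intro m hm
    by_contra h
    simp only [Set.mem_insert_iff, Set.mem_singleton_iff, not_or] at h
    exact hm (Equiv.swap_apply_of_ne_of_ne h.1 h.2))⟩

@[simp]
theorem coe_swapSInf (a b : ℕ) : (swapSInf a b : Equiv.Perm ℕ) = Equiv.swap a b := rfl

theorem starTransposition_inv (n : ℕ) : (starTransposition n)⁻¹ = starTransposition n :=
  Subtype.ext (Equiv.swap_inv 0 n)

theorem conj_starTransposition {σ : SInf} (hσ : (σ : Equiv.Perm ℕ) 0 = 0) (n : ℕ) :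
    σ * starTransposition n * σ⁻¹ = starTransposition ((σ : Equiv.Perm ℕ) n) := by
  refine Subtype.ext ?_
  change (σ : Equiv.Perm ℕ) * Equiv.swap 0 n * (σ : Equiv.Perm ℕ)⁻¹ = Equiv.swap 0 _
  rw [← Equiv.swap_apply_apply, hσ]

theorem conj_prod_starTransposition {σ : SInf} (hσ : (σ : Equiv.Perm ℕ) 0 = 0) (l : List ℕ) :
    σ * (l.map starTransposition).prod * σ⁻¹ =
      ((l.map (σ : Equiv.Perm ℕ)).map starTransposition).prod := by
  rw [← MulAut.conj_apply, map_list_prod, List.map_map, List.map_map]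
  congr 1
  refine List.map_congr_left fun n _ => ?_
  simp [conj_starTransposition hσ]

/-- The permutation is corrected one index at a time by a transposition; equality of the two kernels
keeps the values already matched untouched. -/
theorem exists_perm_map {ι : Type*} [Finite ι] (u v : ι → ℕ) (h : ∀ i j, u i = u j ↔ v i = v j) :
    ∃ σ : SInf, ∀ i, (σ : Equiv.Perm ℕ) (u i) = v i := by
  classical
  have := Fintype.ofFinite ι
  suffices ∀ s : Finset ι, ∃ σ : SInf, ∀ i ∈ s, (σ : Equiv.Perm ℕ) (u i) = v i by
    obtain ⟨σ, hσ⟩ := this Finset.univ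
    exact ⟨σ, fun i => hσ i (Finset.mem_univ i)⟩
  intro s
  induction s using Finset.induction_on with
  | empty => exact ⟨1, by simp⟩
  | insert a s _ ih =>
    obtain ⟨σ, hσ⟩ := ih
    refine ⟨swapSInf ((σ : Equiv.Perm ℕ) (u a)) (v a) * σ, fun i hi => ?_⟩
    change Equiv.swap _ _ ((σ : Equiv.Perm ℕ) (u i)) = _
    by_cases hia : u i = u a
    · rw [hia, Equiv.swap_apply_left, eq_comm]
      exact (h i a).1 hia
    · have his : i ∈ s := by
        rcases Finset.mem_insert.1 hi with rfl | h'
        · exact absurd rfl hia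
        · exact h'
      rw [hσ i his, Equiv.swap_apply_of_ne_of_ne]
      · rw [← hσ i his]
        exact fun h' => hia ((σ : Equiv.Perm ℕ).injective h')
      · exact fun h' => hia ((h i a).2 h')

/-- The character of a word in the star-transpositions depends only on the kernel of the word. -/
theorem character_word_congr {d : ℕ} (w : Fin d → ℝ) {k : ℕ} {f g : Fin k → ℕ}
    (hf : ∀ i, f i ≠ 0) (hg : ∀ i, g i ≠ 0) (h : ∀ i j, f i = f j ↔ g i = g j) :
    character w (List.ofFn fun i => starTransposition (f i)).prod =
      character w (List.ofFn fun i => starTransposition (g i)).prod := by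
  -- The extra index `none` forces the relabelling to fix the distinguished point `0`; this is where
  -- `f` and `g` must avoid `0`.
  obtain ⟨σ, hσ⟩ := exists_perm_map (ι := Option (Fin k)) (fun o => o.elim 0 f)
    (fun o => o.elim 0 g) (by
      rintro (_ | i) (_ | j)
      · simp
      · simp [(hf j).symm, (hg j).symm]
      · simp [hf i, hg i]
      · simpa using h i j)
  have h0 : (σ : Equiv.Perm ℕ) 0 = 0 := hσ none
  have h1 : ∀ i, (σ : Equiv.Perm ℕ) (f i) = g i := fun i => hσ (some i)
  have e : ∀ f : Fin k → ℕ, (List.ofFn fun i => starTransposition (f i)) =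
      (List.ofFn f).map starTransposition := fun f => by rw [List.map_ofFn]; rfl
  rw [e, e, ← character_conj w σ, conj_prod_starTransposition h0]
  simp only [List.map_ofFn]
  congr 4
  funext i
  exact h1 i

/-! ### Convergence of averages -/

section Averages

variable {E : Type*} [NormedAddCommGroup E] [InnerProductSpace ℂ E]

/-- Because `m ≤ n`, each of the `m` rows meets the diagonal once and sums to `n p + (1 - p)`. -/
theorem inner_average_average {v : ℕ → E} {p : ℝ}
    (hv : ∀ i j, i ≠ 0 → j ≠ 0 → inner ℂ (v i) (v j) = if i = j then 1 else (p : ℂ))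
    {m n : ℕ} (hm : m ≠ 0) (hmn : m ≤ n) :
    inner ℂ ((m : ℂ)⁻¹ • ∑ i ∈ Finset.Icc 1 m, v i) ((n : ℂ)⁻¹ • ∑ i ∈ Finset.Icc 1 n, v i) =
      ((p + (1 - p) / n : ℝ) : ℂ) := by
  have hn : n ≠ 0 := by omega
  rw [inner_smul_left, inner_smul_right, sum_inner]
  have : ∀ i ∈ Finset.Icc 1 m, inner ℂ (v i) (∑ j ∈ Finset.Icc 1 n, v j) =
      (n * p + (1 - p) : ℂ) := by
    intro i hi
    rw [Finset.mem_Icc] at hi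
    rw [inner_sum]
    have e : ∀ j ∈ Finset.Icc 1 n, inner ℂ (v i) (v j) =
        (p : ℂ) + if i = j then (1 - p : ℂ) else 0 := by
      intro j hj
      rw [Finset.mem_Icc] at hj
      rw [hv i j (by omega) (by omega)]
      split_ifs <;> simp
    rw [Finset.sum_congr rfl e, Finset.sum_add_distrib, Finset.sum_ite_eq,
      if_pos (Finset.mem_Icc.2 ⟨hi.1, hi.2.trans hmn⟩)]
    simp
  rw [Finset.sum_congr rfl this]
  have hm' : (m : ℂ) ≠ 0 := Nat.cast_ne_zero.2 hm
  have hn' : (n : ℂ) ≠ 0 := Nat.cast_ne_zero.2 hn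
  simp only [Finset.sum_const, Nat.card_Icc, Nat.add_sub_cancel, map_inv₀, map_natCast,
    nsmul_eq_mul]
  push_cast
  field_simp

/-- The averages are Cauchy: for `m ≤ n` their squared distance is `(1 - p) (1/m - 1/n)`. -/
theorem exists_tendsto_average [CompleteSpace E] {v : ℕ → E} {p : ℝ}
    (hv : ∀ i j, i ≠ 0 → j ≠ 0 → inner ℂ (v i) (v j) = if i = j then 1 else (p : ℂ)) :
    ∃ L, Tendsto (fun n : ℕ => (n : ℂ)⁻¹ • ∑ i ∈ Finset.Icc 1 n, v i) atTop (𝓝 L) := by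
  set a : ℕ → E := fun n => (n : ℂ)⁻¹ • ∑ i ∈ Finset.Icc 1 n, v i with ha
  have key : ∀ m n, m ≤ n → dist (a (m + 1)) (a (n + 1)) ≤ √(|1 - p| / ((m : ℝ) + 1)) := by
    intro m n hmn
    have h1 := inner_average_average hv (m := m + 1) (n := m + 1) (by omega) le_rfl
    have h2 := inner_average_average hv (m := n + 1) (n := n + 1) (by omega) le_rfl
    have h3 := inner_average_average hv (m := m + 1) (n := n + 1) (by omega) (by omega)
    refine Real.le_sqrt_of_sq_le ?_
    rw [dist_eq_norm, @norm_sub_sq ℂ, ← inner_self_eq_norm_sq (𝕜 := ℂ),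
      ← inner_self_eq_norm_sq (𝕜 := ℂ), h1, h2, h3]
    simp only [RCLike.re_to_complex, Complex.ofReal_re]
    push_cast
    have h4 : (1 - p) / ((m : ℝ) + 1) - (1 - p) / ((n : ℝ) + 1) ≤ |1 - p| / ((m : ℝ) + 1) := by
      have hm : (0 : ℝ) < (m : ℝ) + 1 := by positivity
      have hmn' : (m : ℝ) + 1 ≤ (n : ℝ) + 1 := by exact_mod_cast Nat.succ_le_succ hmn
      have h5 : ((n : ℝ) + 1)⁻¹ ≤ ((m : ℝ) + 1)⁻¹ := inv_anti₀ hm hmn'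
      have h6 : 0 ≤ ((n : ℝ) + 1)⁻¹ := by positivity
      rw [div_eq_mul_inv, div_eq_mul_inv, div_eq_mul_inv, ← mul_sub]
      calc (1 - p) * (((m : ℝ) + 1)⁻¹ - ((n : ℝ) + 1)⁻¹)
          ≤ |1 - p| * (((m : ℝ) + 1)⁻¹ - ((n : ℝ) + 1)⁻¹) :=
            mul_le_mul_of_nonneg_right (le_abs_self _) (by linarith)
        _ ≤ _ := mul_le_mul_of_nonneg_left (by linarith) (abs_nonneg _)
    linarith
  have hc : CauchySeq fun n => a (n + 1) := by
    refine cauchySeq_of_le_tendsto_0' _ key ?_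
    have h0 : Tendsto (fun m : ℕ => |1 - p| / ((m : ℝ) + 1)) atTop (𝓝 0) :=
      tendsto_const_nhds.div_atTop
        (tendsto_atTop_add_const_right _ _ tendsto_natCast_atTop_atTop)
    have h1 := (Real.continuous_sqrt.tendsto 0).comp h0
    rwa [Real.sqrt_zero] at h1
  obtain ⟨L, hL⟩ := cauchySeq_tendsto_of_complete hc
  exact ⟨L, (tendsto_add_atTop_iff_nat 1).1 hL⟩

/-- Uniformly bounded operators which converge pointwise on a total set converge pointwise. -/
theorem exists_tendsto_of_dense_span [CompleteSpace E] {T : ℕ → E →L[ℂ] E} {C : ℝ}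
    (hT : ∀ n ξ, ‖T n ξ‖ ≤ C * ‖ξ‖) {s : Set E} (hs : Dense (Submodule.span ℂ s : Set E))
    (h : ∀ ξ ∈ s, ∃ L, Tendsto (fun n => T n ξ) atTop (𝓝 L)) (ξ : E) :
    ∃ L, Tendsto (fun n => T n ξ) atTop (𝓝 L) := by
  have hspan : ∀ ξ ∈ Submodule.span ℂ s, ∃ L, Tendsto (fun n => T n ξ) atTop (𝓝 L) := by
    intro ξ hξ
    induction hξ using Submodule.span_induction with
    | mem x hx => exact h x hx
    | zero => exact ⟨0, by simp⟩
    | add x y _ _ hx hy =>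
      obtain ⟨L, hL⟩ := hx
      obtain ⟨M, hM⟩ := hy
      exact ⟨L + M, by simpa using hL.add hM⟩
    | smul c x _ hx =>
      obtain ⟨L, hL⟩ := hx
      exact ⟨c • L, by simpa using hL.const_smul c⟩
  refine cauchySeq_tendsto_of_complete ?_
  rw [Metric.cauchySeq_iff']
  intro ε hε
  have hC : 0 < |C| + 1 := by positivity
  obtain ⟨η, hη, hd⟩ := Metric.mem_closure_iff.1 (hs ξ) (ε / (3 * (|C| + 1))) (by positivity)
  obtain ⟨L, hL⟩ := hspan η hη
  obtain ⟨N, hN⟩ := Metric.cauchySeq_iff'.1 hL.cauchySeq (ε / 3) (by positivity)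
  refine ⟨N, fun n hn => ?_⟩
  have hb : ∀ n, dist (T n ξ) (T n η) < ε / 3 := by
    intro n
    rw [dist_eq_norm, ← map_sub]
    rw [dist_eq_norm] at hd
    calc ‖T n (ξ - η)‖ ≤ C * ‖ξ - η‖ := hT n _
      _ ≤ (|C| + 1) * ‖ξ - η‖ := mul_le_mul_of_nonneg_right
          ((le_abs_self C).trans (by linarith)) (norm_nonneg _)
      _ < (|C| + 1) * (ε / (3 * (|C| + 1))) := mul_lt_mul_of_pos_left hd hC
      _ = ε / 3 := by field_simp
  have h1 := dist_triangle4 (T n ξ) (T n η) (T N η) (T N ξ)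
  have h2 := hb N
  rw [dist_comm] at h2
  linarith [hb n, hN n hn]

end Averages

/-! ### The operators `U(γ_i)` and `A₀` -/

section

variable {d : ℕ} {w : Fin d → ℝ} {H : Type*} [NormedAddCommGroup H] [InnerProductSpace ℂ H]

theorem norm_U_apply (G : GNSRep w H) (σ : SInf) (ξ : H) : ‖G.U σ ξ‖ = ‖ξ‖ := by
  have hspan : Set.EqOn (fun ξ => ‖G.U σ ξ‖) (fun ξ => ‖ξ‖)
      (Submodule.span ℂ (Set.range G.vec) : Set H) := by
    intro x hx
    rw [← Finsupp.range_linearCombination] at hx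
    obtain ⟨l, rfl⟩ := hx
    have e : G.U σ (Finsupp.linearCombination ℂ G.vec l) =
        Finsupp.linearCombination ℂ (fun τ => G.vec (σ * τ)) l := by
      simp [Finsupp.linearCombination_apply, Finsupp.sum, map_sum, G.U_vec]
    change ‖G.U σ (Finsupp.linearCombination ℂ G.vec l)‖ = _
    rw [e]
    refine norm_linearCombination_eq_of_gram (fun τ τ' => ?_) l
    rw [G.inner_vec, G.inner_vec, show σ * τ' * (σ * τ)⁻¹ = σ * (τ' * τ⁻¹) * σ⁻¹ by group,
      character_conj]
  exact congrFun (Continuous.ext_on G.dense_span (G.U σ).continuous.norm continuous_norm hspan) ξ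

/-- The strong operator limit `A₀` of the averages exists. -/
theorem exists_isAverageLimit [CompleteSpace H] (G : GNSRep w H) :
    ∃ A₀ : H →L[ℂ] H, G.IsAverageLimit A₀ := by
  set T : ℕ → H →L[ℂ] H :=
    fun n => (n : ℂ)⁻¹ • ∑ i ∈ Finset.Icc 1 n, G.U (starTransposition i) with hT
  have hb : ∀ n ξ, ‖T n ξ‖ ≤ 1 * ‖ξ‖ := by
    intro n ξ
    simp only [hT, smul_apply, sum_apply, norm_smul,
      norm_inv, Complex.norm_natCast]
    have h1 : ‖∑ i ∈ Finset.Icc 1 n, G.U (starTransposition i) ξ‖ ≤ n * ‖ξ‖ := by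
      refine (norm_sum_le _ _).trans ?_
      simp [norm_U_apply]
    rcases Nat.eq_zero_or_pos n with rfl | hn
    · simp
    · have hn' : (0 : ℝ) < n := Nat.cast_pos.2 hn
      calc (n : ℝ)⁻¹ * _ ≤ (n : ℝ)⁻¹ * (n * ‖ξ‖) := mul_le_mul_of_nonneg_left h1 (by positivity)
        _ = 1 * ‖ξ‖ := by field_simp
  have hvec : ∀ ξ ∈ Set.range G.vec, ∃ L, Tendsto (fun n => T n ξ) atTop (𝓝 L) := by
    rintro _ ⟨τ, rfl⟩
    -- The factor `τ` cancels, and for `i ≠ j` the product of the two star-transpositions is a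
    -- 3-cycle, so the off-diagonal entries are all equal.
    have key : ∀ i j, i ≠ 0 → j ≠ 0 →
        inner ℂ (G.vec (starTransposition i * τ)) (G.vec (starTransposition j * τ)) =
          if i = j then 1 else
            ((character w (starTransposition 2 * starTransposition 1) : ℝ) : ℂ) := by
      intro i j hi hj
      rw [G.inner_vec, mul_inv_rev, starTransposition_inv, mul_assoc, mul_inv_cancel_left]
      split_ifs with hij
      · subst hij
        have : starTransposition i * starTransposition i = 1 := by
          rw [← mul_inv_cancel (starTransposition i), starTransposition_inv]
        rw [this, character_one, Complex.ofReal_one]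
      · have := character_word_congr w (k := 2) (f := ![j, i]) (g := ![2, 1])
          (by intro a; fin_cases a <;> simpa) (by intro a; fin_cases a <;> simp)
          (by intro a b; fin_cases a <;> fin_cases b <;> simp [hij, Ne.symm hij])
        simp only [List.ofFn_succ, Matrix.cons_val_zero, List.ofFn_zero,
          Matrix.cons_val_succ, List.prod_cons, List.prod_nil, mul_one] at this
        rw [this]
    obtain ⟨L, hL⟩ := exists_tendsto_average key
    refine ⟨L, hL.congr fun n => ?_⟩
    simp [hT, G.U_vec]
  have hall := exists_tendsto_of_dense_span hb G.dense_span hvec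
  choose L hL using hall
  exact ⟨continuousLinearMapOfTendsto T (tendsto_pi_nhds.2 hL), fun ξ => hL ξ⟩

theorem U_isSymmetric (G : GNSRep w H) (n : ℕ) :
    ((G.U (starTransposition n) : H →L[ℂ] H) : H →ₗ[ℂ] H).IsSymmetric := by
  set S := G.U (starTransposition n)
  have h1 : ∀ σ τ, inner ℂ (S (G.vec σ)) (G.vec τ) = inner ℂ (G.vec σ) (S (G.vec τ)) := by
    intro σ τ
    rw [G.U_vec, G.U_vec, G.inner_vec, G.inner_vec, mul_inv_rev, starTransposition_inv,
      ← mul_assoc, character_mul_comm, mul_assoc]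
  have h2 : ∀ σ y, inner ℂ (S (G.vec σ)) y = inner ℂ (G.vec σ) (S y) := by
    intro σ y
    refine congrFun (Continuous.ext_on G.dense_span (f := fun y => inner ℂ (S (G.vec σ)) y)
      (g := fun y => inner ℂ (G.vec σ) (S y)) (by fun_prop) (by fun_prop) ?_) y
    intro y hy
    induction hy using Submodule.span_induction with
    | mem x hx => obtain ⟨τ, rfl⟩ := hx; exact h1 σ τ
    | zero => simp
    | add x y _ _ hx hy =>
      simp only [map_add, inner_add_right] at hx hy ⊢
      rw [hx, hy]
    | smul c x _ hx =>
      simp only [map_smul, inner_smul_right] at hx ⊢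
      rw [hx]
  intro x y
  refine congrFun (Continuous.ext_on G.dense_span (f := fun x => inner ℂ (S x) y)
      (g := fun x => inner ℂ x (S y)) (by fun_prop) (by fun_prop) ?_) x
  intro x hx
  induction hx using Submodule.span_induction with
  | mem x hx => obtain ⟨τ, rfl⟩ := hx; exact h2 τ y
  | zero => simp
  | add x y _ _ hx hy =>
    simp only [map_add, inner_add_left] at hx hy ⊢
    rw [hx, hy]
  | smul c x _ hx =>
    simp only [map_smul, inner_smul_left] at hx ⊢
    rw [hx]

theorem GNSRep.IsAverageLimit.isSymmetric {G : GNSRep w H} {A₀ : H →L[ℂ] H}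
    (hA : G.IsAverageLimit A₀) : (A₀ : H →ₗ[ℂ] H).IsSymmetric := by
  intro x y
  refine tendsto_nhds_unique ((hA x).inner tendsto_const_nhds) ?_
  refine (Tendsto.inner (𝕜 := ℂ) tendsto_const_nhds (hA y)).congr fun n => ?_
  simp only [smul_apply, sum_apply, inner_smul_left,
    inner_smul_right, sum_inner, inner_sum, map_inv₀, map_natCast]
  congr 1
  exact Finset.sum_congr rfl fun i _ => (U_isSymmetric G i x y).symm

theorem rescaledAverage_isSymmetric {G : GNSRep w H} {A₀ : H →L[ℂ] H}
    (hA : G.IsAverageLimit A₀) (n : ℕ) :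
    (G.rescaledAverage A₀ n : H →ₗ[ℂ] H).IsSymmetric := by
  intro x y
  have h1 := fun i => U_isSymmetric G i x y
  have h2 := hA.isSymmetric x y
  simp only [ContinuousLinearMap.coe_coe] at h1 h2 ⊢
  simp only [GNSRep.rescaledAverage, smul_apply,
    sum_apply, sub_apply, inner_smul_left,
    inner_smul_right, sum_inner, inner_sum, inner_sub_left, inner_sub_right, map_inv₀,
    Complex.conj_ofReal, h1, h2]

/-! ### Expectations of words -/

/-- The letter `(i, false)` stands for `U(γ_i)`, the letter `(i, true)` for `A₀`. -/
def letterOp (G : GNSRep w H) (A₀ : H →L[ℂ] H) (a : ℕ × Bool) : H →L[ℂ] H :=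
  if a.2 then A₀ else G.U (starTransposition a.1)

/-- The character of the product of the star-transpositions with indices in a list. -/
noncomputable def wordCharacter (w : Fin d → ℝ) (l : List ℕ) : ℝ :=
  character w (l.map starTransposition).prod

theorem wordCharacter_map {σ : SInf} (hσ : (σ : Equiv.Perm ℕ) 0 = 0) (l : List ℕ) :
    wordCharacter w (l.map (σ : Equiv.Perm ℕ)) = wordCharacter w l := by
  rw [wordCharacter, wordCharacter, ← conj_prod_starTransposition hσ, character_conj]

/-- Conjugation by the transposition of `i` and `m` fixes `0` and every other letter of the word. -/
theorem wordCharacter_replace {P Q : List ℕ} {m i : ℕ} (hm : m ≠ 0) (hi : i ≠ 0)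
    (hmP : m ∉ P ++ Q) (hiP : i ∉ P ++ Q) :
    wordCharacter w (P ++ i :: Q) = wordCharacter w (P ++ m :: Q) := by
  have h0 : (swapSInf i m : Equiv.Perm ℕ) 0 = 0 :=
    Equiv.swap_apply_of_ne_of_ne hi.symm hm.symm
  have hfix : ∀ L : List ℕ, L ⊆ P ++ Q → L.map (swapSInf i m : Equiv.Perm ℕ) = L := by
    intro L hL
    conv_rhs => rw [← List.map_id L]
    refine List.map_congr_left fun a ha => ?_
    refine Equiv.swap_apply_of_ne_of_ne ?_ ?_
    · rintro rfl; exact hiP (hL ha)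
    · rintro rfl; exact hmP (hL ha)
  rw [← wordCharacter_map h0 (P ++ i :: Q), List.map_append, List.map_cons,
    hfix P (List.subset_append_left _ _), hfix Q (List.subset_append_right _ _)]
  simp

theorem prod_letterOp_apply_of_forall_false (G : GNSRep w H) (A₀ : H →L[ℂ] H)
    {l : List (ℕ × Bool)} (hl : ∀ a ∈ l, a.2 = false) :
    (l.map (letterOp G A₀)).prod (G.vec 1) =
      G.vec ((l.map Prod.fst).map starTransposition).prod := by
  induction l with
  | nil => simp
  | cons a l ih =>
    have h1 := ih fun b hb => hl b (List.mem_cons_of_mem _ hb)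
    have h2 : letterOp G A₀ a = G.U (starTransposition a.1) := by
      simp [letterOp, hl a List.mem_cons_self]
    rw [List.map_cons, List.prod_cons, mul_apply_eq_comp, h1, h2, G.U_vec]
    simp

theorem sum_Icc_one_eq_sum_range {M : Type*} [AddCommMonoid M] (c : ℕ → M) (n : ℕ) :
    ∑ i ∈ Finset.Icc 1 n, c i = ∑ i ∈ Finset.range n, c (i + 1) := by
  rw [Finset.range_eq_Ico, Finset.sum_Ico_add' c 0 n 1]
  rfl

/-- The index attached to a letter `A₀` is a placeholder occurring nowhere else in the word. By
induction on the number of such letters, one `A₀` is written as the limit of averages of `U(γ_i)`.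
For all but finitely many `i` the index is new to the word, and the expectation then has the same
value as with the placeholder. -/
theorem inner_prod_letterOp {G : GNSRep w H} {A₀ : H →L[ℂ] H} (hA : G.IsAverageLimit A₀)
    (l : List (ℕ × Bool)) (h0 : ∀ a ∈ l, a.1 ≠ 0)
    (hfresh : ∀ m, (m, true) ∈ l → (l.map Prod.fst).count m = 1) :
    inner ℂ (G.vec 1) ((l.map (letterOp G A₀)).prod (G.vec 1)) =
      (wordCharacter w (l.map Prod.fst) : ℂ) := by
  induction hn : l.countP (fun a => a.2) generalizing l with
  | zero =>
    rw [List.countP_eq_zero] at hn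
    rw [prod_letterOp_apply_of_forall_false G A₀ (by simpa using hn), G.inner_vec, inv_one,
      mul_one]
    rfl
  | succ n ih =>
    obtain ⟨⟨m, b⟩, ha, hb⟩ := List.countP_pos_iff.1 (show 0 < l.countP (fun a => a.2) by omega)
    obtain rfl : b = true := hb
    obtain ⟨P, Q, rfl⟩ := List.append_of_mem ha
    have hm0 : m ≠ 0 := h0 _ ha
    have hmc := hfresh m ha
    simp only [List.map_append, List.map_cons, List.count_append, List.count_cons_self] at hmc
    have hmPQ : m ∉ P.map Prod.fst ++ Q.map Prod.fst := by
      rw [← List.count_eq_zero, List.count_append]; omega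
    have hev : ∀ i, i ≠ 0 → i ∉ P.map Prod.fst ++ Q.map Prod.fst →
        inner ℂ (G.vec 1) (((P ++ (i, false) :: Q).map (letterOp G A₀)).prod (G.vec 1)) =
          (wordCharacter w ((P ++ (m, true) :: Q).map Prod.fst) : ℂ) := by
      intro i hi hiPQ
      rw [ih (P ++ (i, false) :: Q)]
      · simp only [List.map_append, List.map_cons]
        rw [wordCharacter_replace hm0 hi hmPQ hiPQ]
      · intro a ha'
        rcases List.mem_append.1 ha' with h | h
        · exact h0 a (List.mem_append_left _ h)
        · rcases List.mem_cons.1 h with rfl | h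
          · exact hi
          · exact h0 a (List.mem_append_right _ (List.mem_cons_of_mem _ h))
      · intro m' hm'
        have hm'' : (m', true) ∈ P ++ Q := by
          simp only [List.mem_append, List.mem_cons, Prod.mk.injEq, Bool.true_eq_false,
            and_false, false_or] at hm' ⊢
          exact hm'
        have hmem : m' ∈ P.map Prod.fst ++ Q.map Prod.fst := by
          rw [← List.map_append]
          exact List.mem_map.2 ⟨_, hm'', rfl⟩
        have hne : m ≠ m' := by rintro rfl; exact hmPQ hmem
        have hne' : i ≠ m' := by rintro rfl; exact hiPQ hmem
        have := hfresh m' (by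
          rcases List.mem_append.1 hm'' with h | h
          · exact List.mem_append_left _ h
          · exact List.mem_append_right _ (List.mem_cons_of_mem _ h))
        simpa [List.count_cons, hne, hne'] using this
      · simp only [List.countP_append, List.countP_cons] at hn ⊢
        simp only [if_true] at hn
        simp only [Bool.false_eq_true, if_false]
        omega
    set c : ℕ → ℂ := fun i =>
      inner ℂ (G.vec 1) (((P ++ (i, false) :: Q).map (letterOp G A₀)).prod (G.vec 1)) with hc
    have hlim : Tendsto (fun n : ℕ => (n : ℂ)⁻¹ * ∑ i ∈ Finset.Icc 1 n, c i) atTop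
        (𝓝 (inner ℂ (G.vec 1)
          (((P ++ (m, true) :: Q).map (letterOp G A₀)).prod (G.vec 1)))) := by
      have h1 := hA ((Q.map (letterOp G A₀)).prod (G.vec 1))
      have h2 := ((P.map (letterOp G A₀)).prod.continuous.tendsto _).comp h1
      have h3 := Tendsto.inner (𝕜 := ℂ) (tendsto_const_nhds (x := G.vec 1)) h2
      have e1 : ∀ b : ℕ × Bool, ((P ++ b :: Q).map (letterOp G A₀)).prod (G.vec 1) =
          (P.map (letterOp G A₀)).prod (letterOp G A₀ b
            ((Q.map (letterOp G A₀)).prod (G.vec 1))) := by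
        intro b
        simp [List.prod_append]
      rw [e1]
      refine h3.congr fun n => ?_
      simp only [hc, e1, letterOp, Function.comp_apply, smul_apply,
        sum_apply, map_smul, map_sum, inner_smul_right, inner_sum,
        Bool.false_eq_true, if_false]
    refine tendsto_nhds_unique hlim ?_
    have hconst : Tendsto (fun i => c (i + 1)) atTop
        (𝓝 (wordCharacter w ((P ++ (m, true) :: Q).map Prod.fst) : ℂ)) := by
      refine tendsto_const_nhds.congr' ?_
      have hfin : ∀ᶠ i in atTop, i ∉ P.map Prod.fst ++ Q.map Prod.fst := by
        have := (List.finite_toSet (P.map Prod.fst ++ Q.map Prod.fst)).bddAbove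
        obtain ⟨M, hM⟩ := this
        filter_upwards [eventually_gt_atTop M] with i hi hmem
        have := hM hmem
        omega
      filter_upwards [(tendsto_add_atTop_nat 1).eventually hfin] with i hi
      exact (hev (i + 1) (by omega) hi).symm
    -- The finitely many indices already present in the word do not affect the Cesàro limit.
    refine hconst.cesaro_smul.congr fun n => ?_
    rw [sum_Icc_one_eq_sum_range]
    simp

end

/-! ### Centered words -/

/-- Replace the letters in the positions of `S` by new and pairwise distinct ones. -/
def freshen {k : ℕ} (f : Fin k → ℕ) (S : Finset (Fin k)) (h : Fin k) : ℕ :=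
  if h ∈ S then Finset.univ.sup f + 1 + h else f h

section

variable {k : ℕ} {f g : Fin k → ℕ}

theorem freshen_ne_zero (hf : ∀ h, f h ≠ 0) (S : Finset (Fin k)) (h : Fin k) :
    freshen f S h ≠ 0 := by
  unfold freshen
  split_ifs
  · omega
  · exact hf h

/-- The new labels exceed every value of `f`, and adding the position separates them from one
another. -/
theorem freshen_eq_iff (f : Fin k → ℕ) (S : Finset (Fin k)) (i j : Fin k) :
    freshen f S i = freshen f S j ↔ i = j ∨ (i ∉ S ∧ j ∉ S ∧ f i = f j) := by
  have hi : f i ≤ Finset.univ.sup f := Finset.le_sup (Finset.mem_univ i)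
  have hj : f j ≤ Finset.univ.sup f := Finset.le_sup (Finset.mem_univ j)
  unfold freshen
  by_cases h1 : i ∈ S <;> by_cases h2 : j ∈ S <;> simp only [h1, h2, if_true, if_false, not_true,
    not_false_eq_true, false_and, and_false, or_false, true_and, Fin.ext_iff]
  · omega
  · constructor
    · omega
    · intro h
      exact absurd (Fin.ext h ▸ h1) h2
  · constructor
    · omega
    · intro h
      exact absurd (Fin.ext h ▸ h2) h1
  · constructor
    · exact fun h => Or.inr h
    · rintro (h | h)
      · rw [Fin.ext h]
      · exact h

variable {d : ℕ} (w : Fin d → ℝ)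

/-- The character of `γ_{f(1)} ⋯ γ_{f(k)}`. -/
noncomputable def tupleCharacter (f : Fin k → ℕ) : ℝ :=
  character w (List.ofFn fun h => starTransposition (f h)).prod

/-- The expectation of `(U(γ_{f(1)}) - A₀) ⋯ (U(γ_{f(k)}) - A₀)`. -/
noncomputable def centeredMoment (f : Fin k → ℕ) : ℝ :=
  ∑ S : Finset (Fin k), (-1) ^ S.card * tupleCharacter w (freshen f S)

theorem centeredMoment_congr (hf : ∀ h, f h ≠ 0) (hg : ∀ h, g h ≠ 0)
    (h : ∀ i j, f i = f j ↔ g i = g j) : centeredMoment w f = centeredMoment w g := by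
  refine Finset.sum_congr rfl fun S _ => ?_
  congr 1
  refine character_word_congr w (freshen_ne_zero hf S) (freshen_ne_zero hg S) fun i j => ?_
  rw [freshen_eq_iff, freshen_eq_iff, h]

/-- A letter occurring once is already fresh, so freshening position `a` does not change the kernel.
The terms of `S` and `insert a S` therefore cancel. -/
theorem centeredMoment_eq_zero (hf : ∀ h, f h ≠ 0) {a : Fin k} (ha : ∀ b, f b = f a → b = a) :
    centeredMoment w f = 0 := by
  unfold centeredMoment
  rw [← Finset.powerset_univ, ← Finset.insert_erase (Finset.mem_univ a),
    Finset.sum_powerset_insert (Finset.notMem_erase a _), ← Finset.sum_add_distrib]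
  refine Finset.sum_eq_zero fun S hS => ?_
  have haS : a ∉ S := fun h => Finset.notMem_erase a _ (Finset.mem_powerset.1 hS h)
  have : tupleCharacter w (freshen f (insert a S)) = tupleCharacter w (freshen f S) := by
    refine character_word_congr w (freshen_ne_zero hf _) (freshen_ne_zero hf _) fun i j => ?_
    rw [freshen_eq_iff, freshen_eq_iff]
    by_cases hij : i = j
    · simp [hij]
    · simp only [hij, false_or, Finset.mem_insert, not_or]
      constructor
      · rintro ⟨⟨_, h1⟩, ⟨_, h2⟩, h3⟩
        exact ⟨h1, h2, h3⟩
      · rintro ⟨h1, h2, h3⟩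
        refine ⟨⟨?_, h1⟩, ⟨?_, h2⟩, h3⟩
        · rintro rfl
          exact hij (ha j h3.symm).symm
        · rintro rfl
          exact hij (ha i h3)
  rw [this, Finset.card_insert_of_notMem haS, pow_succ]
  ring

theorem abs_centeredMoment_le {w : Fin d → ℝ} (hw_pos : ∀ i, 0 < w i) (hw_sum : ∑ i, w i = 1)
    (f : Fin k → ℕ) : |centeredMoment w f| ≤ 2 ^ k := by
  unfold centeredMoment
  refine (Finset.abs_sum_le_sum_abs _ _).trans ?_
  refine (Finset.sum_le_sum (g := fun _ => (1 : ℝ)) fun S _ => ?_).trans ?_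
  · rw [abs_mul, abs_pow, abs_neg, abs_one, one_pow, one_mul]
    exact abs_character_le_one hw_pos hw_sum _
  · simp

end

section

variable {d : ℕ} {w : Fin d → ℝ} {H : Type*} [NormedAddCommGroup H] [InnerProductSpace ℂ H]
  {G : GNSRep w H} {A₀ : H →L[ℂ] H}

theorem count_ofFn_eq_one {α : Type*} [DecidableEq α] {k : ℕ} {g : Fin k → α} {h : Fin k}
    (hg : ∀ i, g i = g h → i = h) : (List.ofFn g).count (g h) = 1 := by
  rw [List.ofFn_eq_map, List.count, List.countP_map]
  rw [← List.count_eq_one_of_mem (List.nodup_finRange k) (List.mem_finRange h), List.count]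
  refine List.countP_congr fun i _ => ?_
  simp only [Function.comp_apply, beq_iff_eq]
  exact ⟨hg i, fun e => by rw [e]⟩

theorem inner_prod_piecewise (hA : G.IsAverageLimit A₀) {k : ℕ} {f : Fin k → ℕ}
    (hf : ∀ h, f h ≠ 0) (S : Finset (Fin k)) :
    inner ℂ (G.vec 1) ((List.ofFn (S.piecewise (fun _ => A₀)
      (fun h => G.U (starTransposition (f h))))).prod (G.vec 1)) =
      (tupleCharacter w (freshen f S) : ℂ) := by
  have := inner_prod_letterOp hA (List.ofFn fun h => (freshen f S h, decide (h ∈ S))) ?_ ?_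
  · rw [List.map_ofFn, List.map_ofFn, wordCharacter, List.map_ofFn] at this
    rw [tupleCharacter]
    have e : S.piecewise (fun _ => A₀) (fun h => G.U (starTransposition (f h))) =
        letterOp G A₀ ∘ fun h => (freshen f S h, decide (h ∈ S)) := by
      funext h
      by_cases hS : h ∈ S <;> simp [letterOp, freshen, hS]
    rw [e, this]
    rfl
  · intro a ha
    obtain ⟨h, rfl⟩ := (List.mem_ofFn' _ _).1 ha
    exact freshen_ne_zero hf S h
  · intro m hm
    obtain ⟨h, hh⟩ := (List.mem_ofFn' _ _).1 hm
    rw [Prod.mk.injEq, decide_eq_true_iff] at hh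
    obtain ⟨rfl, hS⟩ := hh
    rw [List.map_ofFn]
    refine count_ofFn_eq_one (g := freshen f S) fun i hi => ?_
    rcases (freshen_eq_iff f S i h).1 hi with h1 | h1
    · exact h1
    · exact absurd hS h1.2.1

/-- By multilinearity the product expands over the set `S` of positions at which `-A₀` is selected.
-/
theorem inner_prod_centered (hA : G.IsAverageLimit A₀) {k : ℕ} {f : Fin k → ℕ}
    (hf : ∀ h, f h ≠ 0) :
    inner ℂ (G.vec 1) ((List.ofFn fun h => G.U (starTransposition (f h)) - A₀).prod (G.vec 1)) =
      (centeredMoment w f : ℂ) := by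
  let M := MultilinearMap.mkPiAlgebraFin ℂ k (H →L[ℂ] H)
  have e1 : (List.ofFn fun h => G.U (starTransposition (f h)) - A₀).prod =
      M ((fun _ => (-1 : ℂ) • A₀) + fun h => G.U (starTransposition (f h))) := by
    simp only [M, MultilinearMap.mkPiAlgebraFin_apply]
    congr 2
    funext h
    simp [sub_eq_neg_add]
  have e2 : ∀ S : Finset (Fin k), S.piecewise (fun _ => (-1 : ℂ) • A₀)
      (fun h => G.U (starTransposition (f h))) =
      S.piecewise (fun i => (-1 : ℂ) • S.piecewise (fun _ => A₀)
        (fun h => G.U (starTransposition (f h))) i)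
        (S.piecewise (fun _ => A₀) (fun h => G.U (starTransposition (f h)))) := by
    intro S
    funext h
    by_cases hS : h ∈ S <;> simp [hS]
  rw [e1, MultilinearMap.map_add_univ, sum_apply, inner_sum, centeredMoment, Complex.ofReal_sum]
  refine Finset.sum_congr rfl fun S _ => ?_
  rw [e2, MultilinearMap.map_piecewise_smul, Finset.prod_const, smul_apply, inner_smul_right,
    MultilinearMap.mkPiAlgebraFin_apply, inner_prod_piecewise hA hf]
  push_cast
  rfl

/-- The moments of the rescaled averages. -/
theorem inner_rescaledAverage_pow (hA : G.IsAverageLimit A₀) (n k : ℕ) :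
    inner ℂ (G.vec 1) ((G.rescaledAverage A₀ n ^ k) (G.vec 1)) =
      (((√n)⁻¹ ^ k * ∑ f ∈ Fintype.piFinset fun _ : Fin k => Finset.Icc 1 n,
        centeredMoment w f : ℝ) : ℂ) := by
  have e : (∑ i ∈ Finset.Icc 1 n, (G.U (starTransposition i) - A₀)) ^ k =
      ∑ f ∈ Fintype.piFinset fun _ : Fin k => Finset.Icc 1 n,
        (List.ofFn fun h => G.U (starTransposition (f h)) - A₀).prod := by
    rw [← MultilinearMap.mkPiAlgebraFin_apply_const (R := ℂ), MultilinearMap.map_sum_finset]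
    rfl
  rw [GNSRep.rescaledAverage, smul_pow, e, smul_apply, inner_smul_right, sum_apply, inner_sum]
  push_cast
  congr 1
  refine Finset.sum_congr rfl fun f hf => inner_prod_centered hA fun h => ?_
  have := Finset.mem_Icc.1 (Fintype.mem_piFinset.1 hf h)
  omega

end

/-! ### Grouping tuples by their kernel -/

section

variable {k : ℕ}

theorem mem_part_iff (π : SetPartition k) (a b : Fin k) :
    a ∈ π.part b ↔ π.part a = π.part b :=
  π.mem_part_iff_part_eq_part (Finset.mem_univ a) (Finset.mem_univ b)

theorem part_mem_parts (π : SetPartition k) (a : Fin k) : π.part a ∈ π.parts :=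
  π.part_mem.2 (Finset.mem_univ a)

theorem exists_part_eq (π : SetPartition k) {V : Finset (Fin k)} (hV : V ∈ π.parts) :
    ∃ a, π.part a = V := by
  obtain ⟨a, ha⟩ := π.nonempty_of_mem_parts hV
  exact ⟨a, π.part_eq_of_mem hV ha⟩

theorem setPartition_ext {π π' : SetPartition k}
    (h : ∀ a b, π.part a = π.part b ↔ π'.part a = π'.part b) : π = π' := by
  have hp : ∀ a, π.part a = π'.part a := by
    intro a
    ext b
    rw [mem_part_iff, mem_part_iff, h]
  ext V
  constructor
  · intro hV
    obtain ⟨a, rfl⟩ := exists_part_eq π hV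
    rw [hp]
    exact part_mem_parts π' a
  · intro hV
    obtain ⟨a, rfl⟩ := exists_part_eq π' hV
    rw [← hp]
    exact part_mem_parts π a

open Classical in
/-- The partition of the index set of a tuple into the level sets of the tuple. -/
noncomputable def kernelPartition {α : Type*} (f : Fin k → α) : SetPartition k :=
  Finpartition.ofSetoid (Setoid.ker f)

theorem kernelPartition_part_eq_iff {α : Type*} (f : Fin k → α) (a b : Fin k) :
    (kernelPartition f).part a = (kernelPartition f).part b ↔ f a = f b := by
  classical
  rw [← mem_part_iff, kernelPartition, Finpartition.mem_part_ofSetoid_iff_rel]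
  exact eq_comm

theorem kernelPartition_eq_iff {α : Type*} (f : Fin k → α) (π : SetPartition k) :
    kernelPartition f = π ↔ ∀ a b, f a = f b ↔ π.part a = π.part b := by
  constructor
  · rintro rfl a b
    exact (kernelPartition_part_eq_iff f a b).symm
  · intro h
    refine setPartition_ext fun a b => ?_
    rw [kernelPartition_part_eq_iff, h]

theorem max_injOn_parts (π : SetPartition k) {V W : Finset (Fin k)} (hV : V ∈ π.parts)
    (hW : W ∈ π.parts) (h : V.max = W.max) : V = W := by
  obtain ⟨m, hm⟩ := Finset.max_of_nonempty (π.nonempty_of_mem_parts hV)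
  exact π.eq_of_mem_parts hV hW (Finset.mem_of_max hm) (Finset.mem_of_max (h ▸ hm))

/-- Distinct blocks have distinct maxima, and the rank strictly decreases as the maximum grows.
Hence `blockRank π` is a tuple with kernel `π`, used below as the representative of its class. -/
theorem blockRank_eq_iff (π : SetPartition k) (a b : Fin k) :
    blockRank π a = blockRank π b ↔ π.part a = π.part b := by
  have key : ∀ a b, (π.part a).max < (π.part b).max → blockRank π b < blockRank π a := by
    intro a b h
    refine Finset.card_lt_card ?_
    rw [Finset.ssubset_iff_of_subset]
    · refine ⟨π.part a, ?_, ?_⟩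
      · exact Finset.mem_filter.2 ⟨part_mem_parts π a, le_rfl⟩
      · exact fun h' => h.not_ge (Finset.mem_filter.1 h').2
    · intro V hV
      rw [Finset.mem_filter] at hV ⊢
      exact ⟨hV.1, h.le.trans hV.2⟩
  constructor
  · intro h
    rcases lt_trichotomy (π.part a).max (π.part b).max with h' | h' | h'
    · exact absurd h (key a b h').ne'
    · exact max_injOn_parts π (part_mem_parts π a) (part_mem_parts π b) h'
    · exact absurd h (key b a h').ne
  · intro h
    simp only [blockRank, h]

theorem blockRank_ne_zero (π : SetPartition k) (a : Fin k) : blockRank π a ≠ 0 :=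
  Finset.card_ne_zero_of_mem (Finset.mem_filter.2 ⟨part_mem_parts π a, le_rfl⟩)

/-- A tuple with kernel `π` is the same as an injection of the blocks of `π` into `{1, …, n}`. -/
theorem card_tuples_kernelPartition (π : SetPartition k) (n : ℕ) :
    ((Fintype.piFinset fun _ : Fin k => Finset.Icc 1 n).filter
      fun f => kernelPartition f = π).card = n.descFactorial π.parts.card := by
  classical
  have h1 : Fintype.card (π.parts ↪ Finset.Icc 1 n) = n.descFactorial π.parts.card := by
    rw [Fintype.card_embedding_eq, Fintype.card_coe, Fintype.card_coe, Nat.card_Icc,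
      Nat.add_sub_cancel]
  rw [← h1, ← Finset.card_univ]
  symm
  refine Finset.card_bij (fun e _ => fun a => (e ⟨π.part a, part_mem_parts π a⟩ : ℕ)) ?_ ?_ ?_
  · intro e _
    rw [Finset.mem_filter, Fintype.mem_piFinset, kernelPartition_eq_iff]
    refine ⟨fun a => (e _).2, fun a b => ?_⟩
    rw [← Subtype.ext_iff, e.injective.eq_iff, Subtype.mk.injEq]
  · intro e _ e' _ h
    ext ⟨V, hV⟩
    obtain ⟨a, rfl⟩ := exists_part_eq π hV
    exact congrFun h a
  · intro f hf
    rw [Finset.mem_filter, Fintype.mem_piFinset, kernelPartition_eq_iff] at hf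
    obtain ⟨hf1, hf2⟩ := hf
    choose r hr using fun V : π.parts => exists_part_eq π V.2
    refine ⟨⟨fun V => ⟨f (r V), hf1 _⟩, ?_⟩, Finset.mem_univ _, ?_⟩
    · intro V W h
      have := (hf2 _ _).1 (Subtype.ext_iff.1 h)
      rw [hr, hr] at this
      exact Subtype.ext this
    · funext a
      exact (hf2 _ _).2 (hr _)

theorem sum_tuples_eq {d : ℕ} (w : Fin d → ℝ) (n : ℕ) :
    ∑ f ∈ Fintype.piFinset fun _ : Fin k => Finset.Icc 1 n, centeredMoment w f =
      ∑ π : SetPartition k, (n.descFactorial π.parts.card : ℝ) *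
        centeredMoment w (blockRank π) := by
  classical
  rw [← Finset.sum_fiberwise (g := kernelPartition)]
  refine Finset.sum_congr rfl fun π _ => ?_
  rw [← card_tuples_kernelPartition, ← nsmul_eq_mul]
  refine Finset.sum_eq_card_nsmul fun f hf => ?_
  rw [Finset.mem_filter, Fintype.mem_piFinset, kernelPartition_eq_iff] at hf
  refine centeredMoment_congr w (fun h => ?_) (blockRank_ne_zero π) fun i j => ?_
  · have := Finset.mem_Icc.1 (hf.1 h)
    omega
  · rw [hf.2, blockRank_eq_iff]

/-- The pair partitions of `{1, …, k}`. -/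
def pairPartitions (k : ℕ) : Finset (SetPartition k) :=
  {π | ∀ V ∈ π.parts, V.card = 2}

/-- The limits of the moments of the rescaled averages. -/
noncomputable def limitMoment {d : ℕ} (w : Fin d → ℝ) (k : ℕ) : ℝ :=
  ∑ π ∈ pairPartitions k, centeredMoment w (blockRank π)

theorem tendsto_descFactorial_div_pow (p : ℕ) :
    Tendsto (fun n : ℕ => (n.descFactorial p : ℝ) / (n : ℝ) ^ p) atTop (𝓝 1) := by
  have h := isEquivalent_descFactorial p
  have hz : ∀ᶠ n : ℕ in atTop, ((n : ℝ) ^ p) ≠ 0 := by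
    filter_upwards [eventually_gt_atTop 0] with n hn
    positivity
  exact (Asymptotics.isEquivalent_iff_tendsto_one hz).1 h

/-- The falling factorial is asymptotic to `n^p`, so the expression behaves like `n^(-(k - 2p)/2)`.
-/
theorem tendsto_rescaled_count {p : ℕ} (hp : 2 * p ≤ k) :
    Tendsto (fun n : ℕ => (√n)⁻¹ ^ k * (n.descFactorial p : ℝ)) atTop
      (𝓝 (if 2 * p = k then 1 else 0)) := by
  have e : ∀ n : ℕ, (√n)⁻¹ ^ k * (n.descFactorial p : ℝ) =
      (√n)⁻¹ ^ (k - 2 * p) * ((n.descFactorial p : ℝ) / (n : ℝ) ^ p) := by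
    intro n
    have h1 : k = (k - 2 * p) + 2 * p := by omega
    conv_lhs => rw [h1]
    rw [pow_add, pow_mul (√(n : ℝ))⁻¹ 2 p, inv_pow _ 2, Real.sq_sqrt (Nat.cast_nonneg n), inv_pow _ p]
    ring
  simp only [e]
  have h0 : Tendsto (fun n : ℕ => (√(n : ℝ))⁻¹) atTop (𝓝 0) :=
    tendsto_inv_atTop_zero.comp (Real.tendsto_sqrt_atTop.comp tendsto_natCast_atTop_atTop)
  have h2 := (h0.pow (k - 2 * p)).mul (tendsto_descFactorial_div_pow p)
  rw [mul_one] at h2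
  convert! h2 using 2
  split_ifs with h
  · simp [h]
  · rw [zero_pow (by omega)]

/-- Partitions with a singleton have zero centered moment. Without singletons there are at most
`k/2` blocks, with equality only for pair partitions, and fewer blocks are killed by the
normalization. -/
theorem tendsto_rescaled_sum {d : ℕ} (w : Fin d → ℝ) (k : ℕ) :
    Tendsto (fun n : ℕ => (√n)⁻¹ ^ k *
      ∑ f ∈ Fintype.piFinset fun _ : Fin k => Finset.Icc 1 n, centeredMoment w f) atTop
      (𝓝 (limitMoment w k)) := by
  classical
  simp only [sum_tuples_eq, Finset.mul_sum, ← mul_assoc]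
  rw [limitMoment, pairPartitions, Finset.sum_filter]
  refine tendsto_finsetSum _ fun π _ => ?_
  by_cases h1 : ∃ V ∈ π.parts, V.card = 1
  · obtain ⟨V, hV, hc⟩ := h1
    obtain ⟨a, rfl⟩ := Finset.card_eq_one.1 hc
    have hz : centeredMoment w (blockRank π) = 0 := by
      refine centeredMoment_eq_zero w (blockRank_ne_zero π) (a := a) fun b hb => ?_
      rw [blockRank_eq_iff, ← mem_part_iff,
        π.part_eq_of_mem hV (Finset.mem_singleton_self a)] at hb
      exact Finset.mem_singleton.1 hb
    simp [hz]
  · push Not at h1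
    have h2 : ∀ V ∈ π.parts, 2 ≤ V.card := by
      intro V hV
      have := Finset.card_pos.2 (π.nonempty_of_mem_parts hV)
      have := h1 V hV
      omega
    have hsum : ∑ V ∈ π.parts, V.card = k := by
      rw [π.sum_card_parts, Finset.card_univ, Fintype.card_fin]
    have hconst : ∑ _V ∈ π.parts, 2 = 2 * π.parts.card := by
      rw [Finset.sum_const, smul_eq_mul, mul_comm]
    have hle : 2 * π.parts.card ≤ k := by
      exact (hconst.symm.le.trans (Finset.sum_le_sum h2)).trans hsum.le
    have hiff : 2 * π.parts.card = k ↔ ∀ V ∈ π.parts, V.card = 2 := by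
      have h3 := Finset.sum_eq_sum_iff_of_le h2
      rw [hsum, hconst] at h3
      exact h3.trans (forall₂_congr fun V _ => eq_comm)
    have := (tendsto_rescaled_count hle).mul_const (centeredMoment w (blockRank π))
    simp only [hiff, ite_mul, one_mul, zero_mul] at this
    exact this

end

/-! ### Fixed-point-free involutions -/

section Involutions

variable {α : Type*} [DecidableEq α]

/-- The condition says that `S` meets every pair `{x, ρ x}` in `T`, so the sum factors over the
pairs. Each pair gives `-1 - 1 + 1 = -1`: two choices of one element and one choice of both. The
induction removes one pair at a time. -/
theorem sum_sign_covering {ρ : α → α} (hρ : Function.Involutive ρ) (hfix : ∀ x, ρ x ≠ x)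
    (T : Finset α) (hT : ∀ x ∈ T, ρ x ∈ T) :
    ∑ S ∈ T.powerset, (if ∀ x ∈ T, x ∈ S ∨ ρ x ∈ S then (-1 : ℝ) ^ S.card else 0) =
      (-1) ^ (T.card / 2) := by
  induction hn : T.card using Nat.strong_induction_on generalizing T with
  | _ n ih =>
    rcases T.eq_empty_or_nonempty with rfl | ⟨a, ha⟩
    · simp [← hn]
    have hb := hT a ha
    set U := (T.erase a).erase (ρ a) with hU
    have hbU : ρ a ∉ U := Finset.notMem_erase _ _
    have haU : a ∉ U := fun h => Finset.notMem_erase a T (Finset.mem_of_mem_erase h)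
    have hTU : T = insert a (insert (ρ a) U) := by
      rw [hU, Finset.insert_erase (Finset.mem_erase.2 ⟨hfix a, hb⟩), Finset.insert_erase ha]
    have haI : a ∉ insert (ρ a) U := by
      rw [Finset.mem_insert, not_or]
      exact ⟨(hfix a).symm, haU⟩
    have hcard : T.card = U.card + 2 := by
      rw [hTU, Finset.card_insert_of_notMem haI, Finset.card_insert_of_notMem hbU]
    have hUinv : ∀ x ∈ U, ρ x ∈ U := by
      intro x hx
      have hxb : x ≠ ρ a := by rintro rfl; exact hbU hx
      have hxa : x ≠ a := by rintro rfl; exact haU hx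
      have hxT : x ∈ T := Finset.mem_of_mem_erase (Finset.mem_of_mem_erase hx)
      refine Finset.mem_erase.2 ⟨fun h => hxa (hρ.injective h),
        Finset.mem_erase.2 ⟨fun h => hxb ?_, hT x hxT⟩⟩
      rw [← h, hρ x]
    have hrec := ih U.card (by omega) U hUinv rfl
    have hex : ∀ S ∈ U.powerset, a ∉ S ∧ ρ a ∉ S := fun S hS =>
      ⟨fun h => haU (Finset.mem_powerset.1 hS h), fun h => hbU (Finset.mem_powerset.1 hS h)⟩
    -- Once `X` meets the pair `{a, ρ a}`, that pair is covered and the condition only concerns `U`.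
    have hcov : ∀ S X : Finset α, S ∈ U.powerset → X ⊆ {a, ρ a} → X.Nonempty →
        ((∀ x ∈ T, x ∈ X ∪ S ∨ ρ x ∈ X ∪ S) ↔ ∀ x ∈ U, x ∈ S ∨ ρ x ∈ S) := by
      intro S X hS hX hne
      have hmem : ∀ x ∈ U, (x ∈ X ∪ S ↔ x ∈ S) := by
        intro x hx
        rw [Finset.mem_union, or_iff_right]
        intro h
        rcases Finset.mem_insert.1 (hX h) with rfl | h'
        · exact haU hx
        · rw [Finset.mem_singleton.1 h'] at hx
          exact hbU hx
      constructor
      · intro h x hx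
        have := h x (Finset.mem_of_mem_erase (Finset.mem_of_mem_erase hx))
        rwa [hmem x hx, hmem _ (hUinv x hx)] at this
      · intro h x hx
        obtain ⟨y, hy⟩ := hne
        have hy' := hX hy
        rw [Finset.mem_insert, Finset.mem_singleton] at hy'
        rw [hTU, Finset.mem_insert, Finset.mem_insert] at hx
        rcases hx with rfl | rfl | hx
        · rcases hy' with rfl | rfl
          · exact Or.inl (Finset.mem_union_left _ hy)
          · exact Or.inr (Finset.mem_union_left _ hy)
        · rw [hρ a]
          rcases hy' with rfl | rfl
          · exact Or.inr (Finset.mem_union_left _ hy)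
          · exact Or.inl (Finset.mem_union_left _ hy)
        · rw [hmem x hx, hmem _ (hUinv x hx)]
          exact h x hx
    conv_lhs => rw [hTU, Finset.sum_powerset_insert haI, Finset.sum_powerset_insert hbU,
      Finset.sum_powerset_insert hbU]
    rw [← hTU, ← Finset.sum_add_distrib, ← Finset.sum_add_distrib, ← Finset.sum_add_distrib]
    have hterm : ∀ S ∈ U.powerset,
        ((if ∀ x ∈ T, x ∈ S ∨ ρ x ∈ S then (-1 : ℝ) ^ S.card else 0) +
          (if ∀ x ∈ T, x ∈ insert (ρ a) S ∨ ρ x ∈ insert (ρ a) S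
            then (-1 : ℝ) ^ (insert (ρ a) S).card else 0) +
          ((if ∀ x ∈ T, x ∈ insert a S ∨ ρ x ∈ insert a S
            then (-1 : ℝ) ^ (insert a S).card else 0) +
          (if ∀ x ∈ T, x ∈ insert a (insert (ρ a) S) ∨ ρ x ∈ insert a (insert (ρ a) S)
            then (-1 : ℝ) ^ (insert a (insert (ρ a) S)).card else 0))) =
        -(if ∀ x ∈ U, x ∈ S ∨ ρ x ∈ S then (-1 : ℝ) ^ S.card else 0) := by
      intro S hS
      obtain ⟨h1, h2⟩ := hex S hS
      have h3 : a ∉ insert (ρ a) S := by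
        rw [Finset.mem_insert, not_or]
        exact ⟨(hfix a).symm, h1⟩
      have c0 : ¬ ∀ x ∈ T, x ∈ S ∨ ρ x ∈ S := fun h => by
        rcases h a ha with h | h
        · exact h1 h
        · exact h2 h
      have c1 := hcov S {ρ a} hS (by simp) (by simp)
      have c2 := hcov S {a} hS (by simp) (by simp)
      have c3 := hcov S {a, ρ a} hS (by simp) (by simp)
      simp only [Finset.insert_union, Finset.singleton_union] at c1 c2 c3
      simp only [c0, c1, c2, c3, if_false, Finset.card_insert_of_notMem h1,
        Finset.card_insert_of_notMem h2, Finset.card_insert_of_notMem h3]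
      split_ifs
      · ring
      · ring
    rw [Finset.sum_congr rfl hterm, Finset.sum_neg_distrib, hrec, ← hn, hcard,
      Nat.add_div_right _ two_pos, pow_succ]
    ring

theorem cycleType_eq_replicate_two_iff [Fintype α] {j : ℕ} (hα : Fintype.card α = 2 * j)
    (τ : Equiv.Perm α) :
    τ.cycleType = Multiset.replicate j 2 ↔ ∀ x, τ (τ x) = x ∧ τ x ≠ x := by
  constructor
  · intro h x
    have hsum := τ.sum_cycleType
    rw [h, Multiset.sum_replicate, smul_eq_mul] at hsum
    have hsupp : τ.support = Finset.univ := by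
      rw [← Finset.card_eq_iff_eq_univ, ← hsum, hα, mul_comm]
    have hord : orderOf τ ∣ 2 := by
      rw [← Equiv.Perm.lcm_cycleType, h, Multiset.lcm_dvd]
      intro b hb
      rw [Multiset.eq_of_mem_replicate hb]
    have hsq := orderOf_dvd_iff_pow_eq_one.1 hord
    refine ⟨?_, ?_⟩
    · have := Equiv.Perm.congr_fun hsq x
      simpa [pow_two] using this
    · rw [← Equiv.Perm.mem_support, hsupp]
      exact Finset.mem_univ x
  · intro h
    have hsupp : τ.support = Finset.univ := by
      ext x
      simp [(h x).2]
    have hsq : τ ^ 2 = 1 := by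
      ext x
      simp [pow_two, (h x).1]
    have hsum := τ.sum_cycleType
    rw [hsupp, Finset.card_univ, hα] at hsum
    have h2 : ∀ b ∈ τ.cycleType, b = 2 := by
      intro b hb
      have h3 := Equiv.Perm.two_le_of_mem_cycleType hb
      have h4 := Nat.le_of_dvd two_pos
        ((Equiv.Perm.dvd_of_mem_cycleType hb).trans (orderOf_dvd_iff_pow_eq_one.2 hsq))
      omega
    have h5 := Multiset.eq_replicate_card.2 h2
    rw [h5, Multiset.sum_replicate, smul_eq_mul] at hsum
    rw [h5]
    congr 1
    omega

/-- At `j = 0` truncated subtraction gives `0!! = 1`, in agreement with the convention `(-1)!! = 1`.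
-/
theorem two_pow_mul_factorial_mul_doubleFactorial (j : ℕ) :
    Nat.doubleFactorial (2 * j - 1) * (2 ^ j * j.factorial) = (2 * j).factorial := by
  rcases j with _ | j
  · simp
  · rw [← Nat.doubleFactorial_two_mul, show 2 * (j + 1) = (2 * j + 1) + 1 by ring,
      Nat.add_sub_cancel, Nat.factorial_eq_mul_doubleFactorial, mul_comm]

/-- These are the permutations whose cycle type is `j` twos, of which there are `(2j)! / (2^j j!)`.
-/
theorem card_fixedPointFree_involutions [Fintype α] {j : ℕ} (hα : Fintype.card α = 2 * j) :
    (Finset.univ.filter fun τ : Equiv.Perm α => ∀ x, τ (τ x) = x ∧ τ x ≠ x).card =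
      Nat.doubleFactorial (2 * j - 1) := by
  have h := Equiv.Perm.card_of_cycleType_mul_eq α (Multiset.replicate j 2)
  rw [if_pos ⟨by rw [Multiset.sum_replicate, hα, smul_eq_mul, mul_comm],
    fun b hb => (Multiset.eq_of_mem_replicate hb).ge⟩] at h
  have hprod : ∏ n ∈ (Multiset.replicate j 2).toFinset,
      ((Multiset.replicate j 2).count n).factorial = j.factorial := by
    rcases Nat.eq_zero_or_pos j with rfl | hj
    · simp
    · rw [Multiset.toFinset_replicate, if_neg hj.ne', Finset.prod_singleton,
        Multiset.count_replicate_self]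
  rw [hprod, Multiset.sum_replicate, smul_eq_mul, mul_comm j 2, hα, Nat.sub_self,
    Nat.factorial_zero, one_mul, Multiset.prod_replicate,
    ← two_pow_mul_factorial_mul_doubleFactorial] at h
  rw [← Nat.eq_of_mul_eq_mul_right (by positivity) h]
  congr 1
  exact Finset.filter_congr fun τ _ => (cycleType_eq_replicate_two_iff hα τ).symm

/-- The number of extensions of an involution by a fixed-point-free involution of its set of fixed
points. -/
theorem card_fixedPointFree_extensions [Fintype α] {σ : Equiv.Perm α} (hσ : ∀ x, σ (σ x) = x)
    {j : ℕ} (hj : (Finset.univ.filter fun x => σ x = x).card = 2 * j) :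
    (Finset.univ.filter fun ρ : Equiv.Perm α =>
      (∀ x, ρ (ρ x) = x ∧ ρ x ≠ x) ∧ ∀ x, σ x ≠ x → ρ x = σ x).card =
      Nat.doubleFactorial (2 * j - 1) := by
  have hcard : Fintype.card {x // σ x = x} = 2 * j := by rw [Fintype.card_subtype, hj]
  rw [← card_fixedPointFree_involutions hcard]
  symm
  -- Here `τ` pairs up the fixed points of `σ`; the product acts as `τ` on them and as `σ`
  -- elsewhere.
  refine Finset.card_bij (fun τ _ => σ * Equiv.Perm.ofSubtype τ) ?_ ?_ ?_
  · intro τ hτ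
    rw [Finset.mem_filter] at hτ ⊢
    have h1 : ∀ x : {x // σ x = x}, (σ * Equiv.Perm.ofSubtype τ) x = τ x := by
      intro x
      rw [Equiv.Perm.mul_apply, Equiv.Perm.ofSubtype_apply_coe, (τ x).2]
    have h2 : ∀ x, σ x ≠ x → (σ * Equiv.Perm.ofSubtype τ) x = σ x := by
      intro x hx
      rw [Equiv.Perm.mul_apply, Equiv.Perm.ofSubtype_apply_of_not_mem τ hx]
    refine ⟨Finset.mem_univ _, fun x => ?_, h2⟩
    by_cases hx : σ x = x
    · have h3 := h1 ⟨x, hx⟩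
      have h4 := hτ.2 ⟨x, hx⟩
      simp only at h3
      rw [h3, h1, h4.1]
      exact ⟨rfl, fun h => h4.2 (Subtype.ext h)⟩
    · have hx' : σ (σ x) ≠ σ x := by rwa [hσ, ne_comm]
      rw [h2 x hx, h2 _ hx', hσ]
      exact ⟨rfl, hx⟩
  · intro τ _ τ' _ h
    exact Equiv.Perm.ofSubtype_injective (mul_left_cancel h)
  · intro ρ hρ
    rw [Finset.mem_filter] at hρ
    obtain ⟨-, hρ1, hρ2⟩ := hρ
    have hmap : ∀ x, σ x = x ↔ σ (ρ x) = ρ x := by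
      have : ∀ x, σ x ≠ x → σ (ρ x) ≠ ρ x := by
        intro x hx
        rw [hρ2 x hx, hσ]
        exact hx.symm
      intro x
      constructor
      · intro hx
        by_contra h
        have := this _ h
        rw [(hρ1 x).1] at this
        exact this hx
      · intro hx
        by_contra h
        exact this x h hx
    refine ⟨ρ.subtypePerm fun x => (hmap x).symm, ?_, ?_⟩
    · rw [Finset.mem_filter]
      refine ⟨Finset.mem_univ _, fun x => ⟨Subtype.ext ?_, fun h => ?_⟩⟩
      · simp [(hρ1 x).1]
      · exact (hρ1 x).2 (Subtype.ext_iff.1 h)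
    · ext x
      by_cases hx : σ x = x
      · rw [Equiv.Perm.mul_apply, Equiv.Perm.ofSubtype_apply_of_mem (p := fun x => σ x = x) _ hx,
          Equiv.Perm.subtypePerm_apply]
        exact (hmap x).1 hx
      · rw [Equiv.Perm.mul_apply, Equiv.Perm.ofSubtype_apply_of_not_mem (p := fun x => σ x = x) _ hx, hρ2 x hx]

/-- The involution which agrees with `ρ` except that the pairs meeting `S` are made fixed. -/
def breakPairs (ρ : α → α) (S : Finset α) (x : α) : α :=
  if x ∈ S ∨ ρ x ∈ S then x else ρ x

theorem breakPairs_involutive {ρ : α → α} (hρ : Function.Involutive ρ) (S : Finset α) :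
    Function.Involutive (breakPairs ρ S) := by
  intro x
  by_cases h : x ∈ S ∨ ρ x ∈ S
  · simp [breakPairs, h]
  · have h' : ¬ (ρ x ∈ S ∨ ρ (ρ x) ∈ S) := by
      rw [hρ x]
      tauto
    have e : breakPairs ρ S x = ρ x := if_neg h
    rw [e]
    exact (if_neg h').trans (hρ x)

end Involutions

/-! ### Involutions and partitions into blocks of size at most two -/

section

variable {k : ℕ}

/-- The partition into the orbits of an involution. -/
noncomputable def orbitPartition (σ : Equiv.Perm (Fin k)) : SetPartition k :=
  kernelPartition fun x => ({x, σ x} : Finset (Fin k))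

/-- The involutions of a finite set. -/
def involutions (k : ℕ) : Finset (Equiv.Perm (Fin k)) :=
  {σ | ∀ x, σ (σ x) = x}

/-- The involutions without fixed points. -/
def fixedPointFreeInvolutions (k : ℕ) : Finset (Equiv.Perm (Fin k)) :=
  {σ | ∀ x, σ (σ x) = x ∧ σ x ≠ x}

theorem mem_involutions {σ : Equiv.Perm (Fin k)} : σ ∈ involutions k ↔ ∀ x, σ (σ x) = x := by
  simp [involutions]

theorem mem_fixedPointFreeInvolutions {σ : Equiv.Perm (Fin k)} :
    σ ∈ fixedPointFreeInvolutions k ↔ ∀ x, σ (σ x) = x ∧ σ x ≠ x := by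
  simp [fixedPointFreeInvolutions]

theorem orbitPartition_part_eq_iff {σ : Equiv.Perm (Fin k)} (hσ : ∀ x, σ (σ x) = x)
    (a b : Fin k) :
    (orbitPartition σ).part a = (orbitPartition σ).part b ↔ a = b ∨ a = σ b := by
  rw [orbitPartition, kernelPartition_part_eq_iff]
  constructor
  · intro h
    have : a ∈ ({b, σ b} : Finset (Fin k)) := by
      rw [← h]
      exact Finset.mem_insert_self _ _
    simpa using this
  · rintro (rfl | rfl)
    · rfl
    · rw [hσ, Finset.pair_comm]

theorem orbitPartition_part {σ : Equiv.Perm (Fin k)} (hσ : ∀ x, σ (σ x) = x) (a : Fin k) :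
    (orbitPartition σ).part a = {a, σ a} := by
  ext b
  rw [mem_part_iff, orbitPartition_part_eq_iff hσ]
  simp

theorem exists_partner {π : SetPartition k} (hπ : π ∈ partitionsLeTwo k) (a : Fin k) :
    ∃ b, π.part a = {a, b} := by
  have h := (Finset.mem_filter.1 hπ).2 _ (part_mem_parts π a)
  have ha : a ∈ π.part a := π.mem_part (Finset.mem_univ a)
  rcases h with h | h
  · obtain ⟨c, hc⟩ := Finset.card_eq_one.1 h
    rw [hc, Finset.mem_singleton] at ha
    exact ⟨a, by rw [hc, ha]; simp⟩
  · obtain ⟨c, e, _, hc⟩ := Finset.card_eq_two.1 h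
    rw [hc, Finset.mem_insert, Finset.mem_singleton] at ha
    rcases ha with rfl | rfl
    · exact ⟨e, hc⟩
    · exact ⟨c, by rw [hc, Finset.pair_comm]⟩

theorem exists_orbitPartition_eq {π : SetPartition k} (hπ : π ∈ partitionsLeTwo k) :
    ∃ σ ∈ involutions k, orbitPartition σ = π := by
  choose f hf using exists_partner hπ
  have hinv : Function.Involutive f := by
    intro x
    have h1 : f x ∈ π.part x := by rw [hf x]; simp
    have h2 := (mem_part_iff π _ _).1 h1
    rw [hf x, hf (f x)] at h2
    have h3 : x ∈ ({f x, f (f x)} : Finset (Fin k)) := by rw [h2]; simp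
    rw [Finset.mem_insert, Finset.mem_singleton] at h3
    rcases h3 with h3 | h3
    · rw [← h3, ← h3]
    · exact h3.symm
  refine ⟨hinv.toPerm, mem_involutions.2 hinv, setPartition_ext fun a b => ?_⟩
  rw [orbitPartition_part_eq_iff (σ := hinv.toPerm) hinv, ← mem_part_iff π, hf b]
  simp

theorem orbitPartition_mem {σ : Equiv.Perm (Fin k)} (hσ : ∀ x, σ (σ x) = x) :
    orbitPartition σ ∈ partitionsLeTwo k := by
  refine Finset.mem_filter.2 ⟨Finset.mem_univ _, fun V hV => ?_⟩
  obtain ⟨a, rfl⟩ := exists_part_eq _ hV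
  rw [orbitPartition_part hσ]
  by_cases h : a = σ a
  · left
    rw [← h]
    simp
  · right
    exact Finset.card_pair h

theorem orbitPartition_injOn : Set.InjOn (orbitPartition (k := k)) (involutions k) := by
  intro σ hσ τ hτ h
  have hσ' := mem_involutions.1 (Finset.mem_coe.1 hσ)
  have hτ' := mem_involutions.1 (Finset.mem_coe.1 hτ)
  ext a
  have h1 := orbitPartition_part hσ' a
  rw [h, orbitPartition_part hτ'] at h1
  have h2 : σ a ∈ ({a, τ a} : Finset (Fin k)) := by rw [h1]; simp
  have h3 : τ a ∈ ({a, σ a} : Finset (Fin k)) := by rw [← h1]; simp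
  rw [Finset.mem_insert, Finset.mem_singleton] at h2 h3
  rcases h2 with h2 | h2
  · rcases h3 with h3 | h3
    · rw [h2, h3]
    · rw [h3]
  · rw [h2]

theorem sum_partitionsLeTwo (g : SetPartition k → ℝ) :
    ∑ π ∈ partitionsLeTwo k, g π = ∑ σ ∈ involutions k, g (orbitPartition σ) := by
  symm
  refine Finset.sum_bij (fun σ _ => orbitPartition σ)
    (fun σ hσ => orbitPartition_mem (mem_involutions.1 hσ))
    (fun σ hσ τ hτ h => orbitPartition_injOn hσ hτ h) (fun π hπ => ?_) fun _ _ => rfl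
  obtain ⟨σ, hσ, h⟩ := exists_orbitPartition_eq hπ
  exact ⟨σ, hσ, h⟩

theorem pairPartitions_subset : pairPartitions k ⊆ partitionsLeTwo k := by
  intro π hπ
  exact Finset.mem_filter.2
    ⟨Finset.mem_univ _, fun V hV => Or.inr ((Finset.mem_filter.1 hπ).2 V hV)⟩

theorem orbitPartition_mem_pairPartitions {σ : Equiv.Perm (Fin k)} (hσ : ∀ x, σ (σ x) = x) :
    orbitPartition σ ∈ pairPartitions k ↔ ∀ x, σ x ≠ x := by
  constructor
  · intro h x hx
    have := (Finset.mem_filter.1 h).2 _ (part_mem_parts (orbitPartition σ) x)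
    rw [orbitPartition_part hσ, hx] at this
    simp at this
  · intro h
    refine Finset.mem_filter.2 ⟨Finset.mem_univ _, fun V hV => ?_⟩
    obtain ⟨a, rfl⟩ := exists_part_eq _ hV
    rw [orbitPartition_part hσ]
    exact Finset.card_pair (h a).symm

theorem sum_pairPartitions (g : SetPartition k → ℝ) :
    ∑ π ∈ pairPartitions k, g π =
      ∑ σ ∈ fixedPointFreeInvolutions k, g (orbitPartition σ) := by
  symm
  refine Finset.sum_bij (fun σ _ => orbitPartition σ) (fun σ hσ => ?_)
    (fun σ hσ τ hτ h => ?_) (fun π hπ => ?_) fun _ _ => rfl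
  · have h := mem_fixedPointFreeInvolutions.1 hσ
    exact (orbitPartition_mem_pairPartitions fun x => (h x).1).2 fun x => (h x).2
  · exact orbitPartition_injOn
      (mem_involutions.2 fun x => (mem_fixedPointFreeInvolutions.1 hσ x).1)
      (mem_involutions.2 fun x => (mem_fixedPointFreeInvolutions.1 hτ x).1) h
  · obtain ⟨σ, hσ, h⟩ := exists_orbitPartition_eq (pairPartitions_subset hπ)
    have hσ' := mem_involutions.1 hσ
    have h2 := (orbitPartition_mem_pairPartitions hσ').1 (h ▸ hπ)
    exact ⟨σ, mem_fixedPointFreeInvolutions.2 fun x => ⟨hσ' x, h2 x⟩, h⟩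

theorem card_pairPartitions (j : ℕ) :
    (pairPartitions (2 * j)).card = Nat.doubleFactorial (2 * j - 1) := by
  have h := sum_pairPartitions (k := 2 * j) fun _ => (1 : ℝ)
  simp only [Finset.sum_const, nsmul_eq_mul, mul_one, Nat.cast_inj] at h
  rw [h, fixedPointFreeInvolutions]
  convert! card_fixedPointFree_involutions (Fintype.card_fin (2 * j))

theorem numSingletons_orbitPartition {σ : Equiv.Perm (Fin k)} (hσ : ∀ x, σ (σ x) = x) :
    numSingletons (orbitPartition σ) = (Finset.univ.filter fun x => σ x = x).card := by
  symm
  refine Finset.card_bij (fun a _ => (orbitPartition σ).part a) ?_ ?_ ?_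
  · intro a ha
    refine Finset.mem_filter.2 ⟨part_mem_parts _ a, ?_⟩
    rw [orbitPartition_part hσ, (Finset.mem_filter.1 ha).2]
    simp
  · intro a _ b hb h
    rw [orbitPartition_part_eq_iff hσ, (Finset.mem_filter.1 hb).2, or_self] at h
    exact h
  · intro V hV
    rw [Finset.mem_filter] at hV
    obtain ⟨a, rfl⟩ := exists_part_eq _ hV.1
    refine ⟨a, Finset.mem_filter.2 ⟨Finset.mem_univ a, ?_⟩, rfl⟩
    by_contra h
    rw [orbitPartition_part hσ, Finset.card_pair (Ne.symm h)] at hV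
    exact absurd hV.2 (by norm_num)

/-- Points moved by an involution come in pairs. This parity makes the division by two in the
exponent of the sign exact. -/
theorem even_card_fixedPoints {σ : Equiv.Perm (Fin k)} (hσ : ∀ x, σ (σ x) = x) (hk : Even k) :
    Even (Finset.univ.filter fun x => σ x = x).card := by
  have hsq : σ ^ 2 ^ 1 = 1 := by
    ext x
    simp [pow_two, hσ x]
  have h := σ.card_compl_support_modEq (p := 2) (n := 1) hsq
  have e : σ.supportᶜ = Finset.univ.filter fun x => σ x = x := by
    ext x
    simp
  rw [e, Fintype.card_fin] at h
  rw [Nat.even_iff] at hk ⊢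
  exact Eq.trans h hk

variable {d : ℕ} (w : Fin d → ℝ)

/-- The involution obtained by breaking the pairs of `ρ` which meet `S`. -/
def breakPairsPerm {ρ : Equiv.Perm (Fin k)} (hρ : ∀ x, ρ (ρ x) = x) (S : Finset (Fin k)) :
    Equiv.Perm (Fin k) :=
  (breakPairs_involutive (ρ := ρ) hρ S).toPerm

theorem breakPairsPerm_mem {ρ : Equiv.Perm (Fin k)} (hρ : ∀ x, ρ (ρ x) = x)
    (S : Finset (Fin k)) : breakPairsPerm hρ S ∈ involutions k :=
  mem_involutions.2 (breakPairs_involutive (ρ := ρ) hρ S)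

/-- A freshened position becomes a singleton, and so does its partner; the level sets are the orbits
of the broken involution. -/
theorem tupleCharacter_freshen {ρ : Equiv.Perm (Fin k)} (hρ : ∀ x, ρ (ρ x) = x)
    (S : Finset (Fin k)) :
    tupleCharacter w (freshen (blockRank (orbitPartition ρ)) S) =
      character w (tau (orbitPartition (breakPairsPerm hρ S))) := by
  refine character_word_congr w (freshen_ne_zero (blockRank_ne_zero _) S)
    (blockRank_ne_zero _) fun i j => ?_
  rw [freshen_eq_iff, blockRank_eq_iff, blockRank_eq_iff, orbitPartition_part_eq_iff hρ,
    orbitPartition_part_eq_iff (mem_involutions.1 (breakPairsPerm_mem hρ S))]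
  change _ ↔ i = j ∨ i = breakPairs ρ S j
  unfold breakPairs
  split_ifs with h
  · constructor
    · rintro (h1 | ⟨h1, h2, rfl | rfl⟩)
      · exact Or.inl h1
      · exact Or.inl rfl
      · tauto
    · tauto
  · constructor
    · rintro (h1 | ⟨h1, h2, h3⟩)
      · exact Or.inl h1
      · exact h3
    · rintro (h1 | rfl)
      · exact Or.inl h1
      · push Not at h
        exact Or.inr ⟨h.2, h.1, Or.inr rfl⟩

/-- Breaking along `S` yields `σ` exactly when `ρ` agrees with `σ` off the fixed points of `σ`, `S`
consists of such fixed points, and `S` meets every `ρ`-pair of them. `sum_sign_covering` then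
evaluates the signed count. -/
theorem sum_sign_breakPairs {ρ σ : Equiv.Perm (Fin k)} (hρ : ∀ x, ρ (ρ x) = x)
    (hfix : ∀ x, ρ x ≠ x) (hσ : ∀ x, σ (σ x) = x) :
    ∑ S : Finset (Fin k), (if breakPairsPerm hρ S = σ then (-1 : ℝ) ^ S.card else 0) =
      if ∀ x, σ x ≠ x → ρ x = σ x then
        (-1) ^ ((Finset.univ.filter fun x => σ x = x).card / 2) else 0 := by
  set T := Finset.univ.filter fun x => σ x = x with hTdef
  have hT : ∀ x, x ∈ T ↔ σ x = x := by simp [T]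
  have hiff : ∀ S : Finset (Fin k), breakPairsPerm hρ S = σ ↔
      (∀ x, σ x ≠ x → ρ x = σ x) ∧ S ⊆ T ∧ ∀ x ∈ T, x ∈ S ∨ ρ x ∈ S := by
    intro S
    rw [Equiv.ext_iff]
    change (∀ x, breakPairs ρ S x = σ x) ↔ _
    constructor
    · intro h
      refine ⟨fun x hx => ?_, fun x hx => ?_, fun x hx => ?_⟩
      · have h1 := h x
        unfold breakPairs at h1
        split_ifs at h1
        · exact absurd h1.symm hx
        · exact h1
      · rw [hT, ← h x]
        simp [breakPairs, hx]
      · by_contra h1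
        have h2 := h x
        rw [(hT x).1 hx, breakPairs, if_neg h1] at h2
        exact hfix x h2
    · rintro ⟨h1, h2, h3⟩ x
      unfold breakPairs
      split_ifs with h
      · rcases h with h | h
        · exact ((hT x).1 (h2 h)).symm
        · by_contra hx
          have h4 : σ x ≠ x := fun h => hx h.symm
          have h5 := (hT _).1 (h2 h)
          rw [h1 x h4, hσ] at h5
          exact hx h5
      · by_cases hx : σ x = x
        · exact absurd (h3 x ((hT x).2 hx)) h
        · exact h1 x hx
  simp only [hiff]
  split_ifs with hext
  · have hTinv : ∀ x ∈ T, ρ x ∈ T := by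
      intro x hx
      rw [hT] at hx ⊢
      by_contra h
      have h1 := hext _ h
      rw [hρ] at h1
      have h2 := hσ (ρ x)
      rw [← h1, hx] at h2
      exact hfix x h2.symm
    rw [← sum_sign_covering (ρ := ρ) hρ hfix T hTinv]
    rw [← Finset.sum_subset (Finset.subset_univ T.powerset)]
    · refine Finset.sum_congr rfl fun S hS => ?_
      simp only [Finset.mem_powerset.1 hS, true_and, and_iff_right hext]
      congr
    · intro S _ hS
      exact if_neg fun h => hS (Finset.mem_powerset.2 h.2.1)
  · exact Finset.sum_eq_zero fun S _ => if_neg fun h => hext h.1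

/-- Each centered moment is regrouped by the involution `σ` left after breaking pairs. Exchanging
the sums leaves, for each `σ`, the sign times the number of fixed-point-free `ρ` extending it. -/
theorem limitMoment_eq (hk : Even k) :
    limitMoment w k = ∑ π ∈ partitionsLeTwo k,
      (-1 : ℝ) ^ (numSingletons π / 2) * (Nat.doubleFactorial (numSingletons π - 1) : ℝ) *
        character w (tau π) := by
  have step : ∀ ρ ∈ fixedPointFreeInvolutions k,
      centeredMoment w (blockRank (orbitPartition ρ)) =
        ∑ σ ∈ involutions k, (if ∀ x, σ x ≠ x → ρ x = σ x then
          (-1 : ℝ) ^ ((Finset.univ.filter fun x => σ x = x).card / 2) else 0) *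
          character w (tau (orbitPartition σ)) := by
    intro ρ hρ
    have hρ' := mem_fixedPointFreeInvolutions.1 hρ
    have hρ1 : ∀ x, ρ (ρ x) = x := fun x => (hρ' x).1
    unfold centeredMoment
    simp only [tupleCharacter_freshen w hρ1]
    rw [← Finset.sum_fiberwise_of_maps_to (g := fun S => breakPairsPerm hρ1 S)
      fun S _ => breakPairsPerm_mem hρ1 S]
    refine Finset.sum_congr rfl fun σ hσ => ?_
    rw [← sum_sign_breakPairs hρ1 (fun x => (hρ' x).2) (mem_involutions.1 hσ), Finset.sum_mul,
      Finset.sum_filter]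
    refine Finset.sum_congr rfl fun S _ => ?_
    split_ifs with h
    · rw [h]
    · rw [zero_mul]
  rw [limitMoment, sum_pairPartitions, Finset.sum_congr rfl step, Finset.sum_comm,
    sum_partitionsLeTwo]
  refine Finset.sum_congr rfl fun σ hσ => ?_
  have hσ' := mem_involutions.1 hσ
  obtain ⟨j, hj⟩ := even_card_fixedPoints hσ' hk
  rw [← two_mul] at hj
  have hcount := card_fixedPointFree_extensions hσ' hj
  have hcount' : ((fixedPointFreeInvolutions k).filter
      fun ρ => ∀ x, σ x ≠ x → ρ x = σ x).card = Nat.doubleFactorial (2 * j - 1) := by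
    rw [fixedPointFreeInvolutions, Finset.filter_filter, ← hcount]
    congr!
  rw [← Finset.sum_mul, ← Finset.sum_filter, Finset.sum_const, hcount',
    numSingletons_orbitPartition hσ', hj, nsmul_eq_mul]
  ring

theorem abs_limitMoment_le {w : Fin d → ℝ} (hw_pos : ∀ i, 0 < w i) (hw_sum : ∑ i, w i = 1)
    (j : ℕ) : |limitMoment w (2 * j)| ≤ 4 ^ j * Nat.doubleFactorial (2 * j - 1) := by
  refine (Finset.abs_sum_le_sum_abs _ _).trans ?_
  refine (Finset.sum_le_sum fun π _ => abs_centeredMoment_le hw_pos hw_sum _).trans ?_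
  rw [Finset.sum_const, card_pairPartitions, nsmul_eq_mul, pow_mul, mul_comm]
  norm_num

end

/-! ### The law of a self-adjoint operator in a vector state -/

section Law

variable {H : Type*} [NormedAddCommGroup H] [InnerProductSpace ℂ H] [CompleteSpace H]

/-- The continuous functional calculus makes the vector state a positive functional on functions on
the compact spectrum. The law is the Riesz–Markov measure pushed forward to the line. -/
theorem exists_isLaw {T : H →L[ℂ] H} (hT : (T : H →ₗ[ℂ] H).IsSymmetric) {ξ : H} (hξ : ‖ξ‖ = 1) :
    ∃ μ : ProbabilityMeasure ℝ, IsLaw T ξ μ := by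
  have hsa : IsSelfAdjoint T := ContinuousLinearMap.isSelfAdjoint_iff_isSymmetric.2 hT
  let Φ := cfcHom (R := ℝ) hsa
  let L : CompactlySupportedContinuousMap (spectrum ℝ T) ℝ →ₗ[ℝ] ℝ :=
    { toFun := fun f => (inner ℂ ξ (Φ f.toContinuousMap ξ)).re
      map_add' := fun f g => by
        have : (f + g).toContinuousMap = f.toContinuousMap + g.toContinuousMap := rfl
        rw [this, map_add, add_apply, inner_add_right, Complex.add_re]
      map_smul' := fun c f => by
        have : (c • f).toContinuousMap = c • f.toContinuousMap := rfl
        rw [this, map_smul, smul_apply, RCLike.real_smul_eq_coe_smul (K := ℂ), inner_smul_right]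
        simp }
  have hL : ∀ f, 0 ≤ f → 0 ≤ L f := by
    intro f hf
    -- Writing `f = g* g` turns the value of the functional into a squared norm.
    let g : C(spectrum ℝ T, ℝ) := ⟨fun x => √(f x), by fun_prop⟩
    have hg : f.toContinuousMap = star g * g := by
      ext x
      exact (Real.mul_self_sqrt (hf x)).symm
    change 0 ≤ (inner ℂ ξ (Φ f.toContinuousMap ξ)).re
    rw [hg, map_mul, map_star, ContinuousLinearMap.star_eq_adjoint]
    change 0 ≤ (inner ℂ ξ ((ContinuousLinearMap.adjoint (Φ g)) (Φ g ξ))).re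
    rw [ContinuousLinearMap.adjoint_inner_right]
    exact inner_self_nonneg (𝕜 := ℂ)
  let Λ := PositiveLinearMap.mk₀ L hL
  let m := RealRMK.rieszMeasure Λ
  have hpow : ∀ k : ℕ, ∫ x, (x : ℝ) ^ k ∂m = (inner ℂ ξ ((T ^ k) ξ)).re := by
    intro k
    let q : C(spectrum ℝ T, ℝ) := ((ContinuousMap.id ℝ).restrict (spectrum ℝ T)) ^ k
    have h := RealRMK.integral_rieszMeasure Λ ⟨q, HasCompactSupport.of_compactSpace q⟩
    have h2 : Φ q = T ^ k := by
      simp only [q, map_pow, Φ]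
      rw [cfcHom_id]
    have h3 : Λ ⟨q, HasCompactSupport.of_compactSpace q⟩ = (inner ℂ ξ (Φ q ξ)).re := rfl
    rw [h3, h2] at h
    exact h
  have hprob : m Set.univ = 1 := by
    have h := hpow 0
    simp only [pow_zero, integral_const, smul_eq_mul, mul_one, one_apply_eq_self,
      inner_self_eq_norm_sq_to_K, hξ] at h
    rw [measureReal_def] at h
    rw [← ENNReal.toReal_eq_one_iff, h]
    simp
  have : IsProbabilityMeasure m := ⟨hprob⟩
  have hval : Measurable (Subtype.val : spectrum ℝ T → ℝ) := measurable_subtype_coe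
  refine ⟨⟨m.map Subtype.val, Measure.isProbabilityMeasure_map hval.aemeasurable⟩, ?_, ?_⟩
  · obtain ⟨R, hR⟩ := (ContinuousFunctionalCalculus.isCompact_spectrum (R := ℝ) (p := IsSelfAdjoint)
      T).isBounded.exists_norm_le
    refine ⟨R, ?_⟩
    change ∀ᵐ t ∂(m.map Subtype.val), |t| ≤ R
    rw [ae_map_iff hval.aemeasurable (measurableSet_le (by fun_prop) measurable_const)]
    exact Eventually.of_forall fun x => hR x x.2
  · intro k
    change ((∫ t, t ^ k ∂(m.map Subtype.val) : ℝ) : ℂ) = _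
    rw [integral_map hval.aemeasurable (by fun_prop), hpow]
    have hs : ((T ^ k : H →L[ℂ] H) : H →ₗ[ℂ] H).IsSymmetric :=
      ContinuousLinearMap.isSelfAdjoint_iff_isSymmetric.1 (hsa.pow k)
    exact hs.coe_re_inner_self_apply ξ

omit [CompleteSpace H] in
theorem IsLaw.integrable_pow {T : H →L[ℂ] H} {ξ : H} {μ : ProbabilityMeasure ℝ}
    (h : IsLaw T ξ μ) (k : ℕ) : Integrable (fun t : ℝ => t ^ k) (μ : Measure ℝ) := by
  obtain ⟨R, hR⟩ := h.1
  refine Integrable.of_bound (by fun_prop) (R ^ k) ?_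
  filter_upwards [hR] with t ht
  rw [norm_pow, Real.norm_eq_abs]
  exact pow_le_pow_left₀ (abs_nonneg t) ht k

end Law

/-! ### The method of moments -/

section Moments

/-- Since `(2j)! = (2j-1)!! 2^j j!`, the even terms are dominated by the exponential series of `2
t²`; the odd terms are controlled by their even neighbours. -/
theorem summable_integral_abs_pow {μ : Measure ℝ} (hint : ∀ k : ℕ, Integrable (fun x => x ^ k) μ)
    (hbound : ∀ j : ℕ, ∫ x, x ^ (2 * j) ∂μ ≤ 4 ^ j * Nat.doubleFactorial (2 * j - 1)) (t : ℝ) :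
    Summable fun k : ℕ => ∫ x, |t * x| ^ k / k.factorial ∂μ := by
  have habs : ∀ k : ℕ, Integrable (fun x => |t * x| ^ k / k.factorial) μ := by
    intro k
    have := ((hint k).norm.const_mul (|t| ^ k)).div_const (k.factorial : ℝ)
    refine this.congr (Eventually.of_forall fun x => ?_)
    simp only [norm_pow, Real.norm_eq_abs, abs_mul, mul_pow]
  have heven : ∀ j : ℕ, ∫ x, |t * x| ^ (2 * j) / (2 * j).factorial ∂μ ≤
      (2 * t ^ 2) ^ j / j.factorial := by
    intro j
    have e : ∀ x : ℝ, |t * x| ^ (2 * j) / (2 * j).factorial =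
        t ^ (2 * j) / (2 * j).factorial * x ^ (2 * j) := by
      intro x
      rw [pow_mul, sq_abs, ← pow_mul, mul_pow]
      ring
    simp only [e]
    rw [integral_const_mul]
    have ht : 0 ≤ t ^ (2 * j) / ((2 * j).factorial : ℝ) := by
      rw [pow_mul]; positivity
    refine (mul_le_mul_of_nonneg_left (hbound j) ht).trans (le_of_eq ?_)
    have h1 : ((2 * j).factorial : ℝ) =
        Nat.doubleFactorial (2 * j - 1) * (2 ^ j * j.factorial) := by
      exact_mod_cast (two_pow_mul_factorial_mul_doubleFactorial j).symm
    have h2 : (Nat.doubleFactorial (2 * j - 1) : ℝ) ≠ 0 := by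
      exact_mod_cast (Nat.doubleFactorial_pos _).ne'
    rw [h1, mul_pow, pow_mul, show (4 : ℝ) = 2 * 2 by norm_num, mul_pow]
    field_simp
  -- From `y ≤ 1 + y²` come the even terms `j` and `j + 1`, the latter with weight `2j + 2`; this
  -- weight cancels against `(j + 1)!` and leaves the factor `2 (2 t²)`.
  have hodd : ∀ j : ℕ, ∫ x, |t * x| ^ (2 * j + 1) / (2 * j + 1).factorial ∂μ ≤
      (2 * t ^ 2) ^ j / j.factorial * (1 + 2 * (2 * t ^ 2)) := by
    intro j
    have h1 : ∫ x, |t * x| ^ (2 * j + 1) / (2 * j + 1).factorial ∂μ ≤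
        ∫ x, (|t * x| ^ (2 * j) / (2 * j).factorial +
          (2 * j + 2) * (|t * x| ^ (2 * (j + 1)) / (2 * (j + 1)).factorial)) ∂μ := by
      refine integral_mono (habs _) ((habs _).add ((habs _).const_mul _)) fun x => ?_
      set y := |t * x|
      have hy : 0 ≤ y := abs_nonneg _
      have hf1 : ((2 * j + 1).factorial : ℝ) = (2 * j + 1) * (2 * j).factorial := by
        rw [Nat.factorial_succ]; push_cast; ring
      have hf2 : ((2 * (j + 1)).factorial : ℝ) = (2 * j + 2) * (2 * j + 1).factorial := by
        rw [show 2 * (j + 1) = (2 * j + 1) + 1 by ring, Nat.factorial_succ]; push_cast; ring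
      have hp : (0 : ℝ) < (2 * j + 1).factorial := by positivity
      have hq : (0 : ℝ) < (2 * j).factorial := by positivity
      have e2 : (2 * (j : ℝ) + 2) * (y ^ (2 * (j + 1)) / (2 * (j + 1)).factorial) =
          y ^ (2 * (j + 1)) / (2 * j + 1).factorial := by
        rw [hf2]; field_simp
      have h3 : y ^ (2 * j + 1) ≤ y ^ (2 * j) + y ^ (2 * (j + 1)) := by
        have : y ≤ 1 + y ^ 2 := by nlinarith [sq_nonneg (y - 1)]
        calc y ^ (2 * j + 1) = y ^ (2 * j) * y := pow_succ _ _
          _ ≤ y ^ (2 * j) * (1 + y ^ 2) := mul_le_mul_of_nonneg_left this (by positivity)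
          _ = _ := by ring
      have h4 : y ^ (2 * j) / ((2 * j + 1).factorial : ℝ) ≤ y ^ (2 * j) / (2 * j).factorial := by
        refine div_le_div_of_nonneg_left (by positivity) hq ?_
        exact_mod_cast Nat.factorial_le (Nat.le_succ _)
      change y ^ (2 * j + 1) / ((2 * j + 1).factorial : ℝ) ≤ _ + _
      rw [e2]
      calc y ^ (2 * j + 1) / ((2 * j + 1).factorial : ℝ)
          ≤ (y ^ (2 * j) + y ^ (2 * (j + 1))) / (2 * j + 1).factorial :=
            div_le_div_of_nonneg_right h3 hp.le
        _ = y ^ (2 * j) / (2 * j + 1).factorial + y ^ (2 * (j + 1)) / (2 * j + 1).factorial :=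
            add_div _ _ _
        _ ≤ _ := by linarith
    rw [integral_add (habs _) ((habs _).const_mul _), integral_const_mul] at h1
    refine h1.trans ?_
    have h5 := heven j
    have h6 := mul_le_mul_of_nonneg_left (heven (j + 1)) (show (0 : ℝ) ≤ 2 * j + 2 by positivity)
    refine (add_le_add h5 h6).trans (le_of_eq ?_)
    rw [Nat.factorial_succ]
    push_cast
    field_simp
    ring
  have hs := Real.summable_pow_div_factorial (2 * t ^ 2)
  refine Summable.even_add_odd ?_ ?_
  · exact Summable.of_nonneg_of_le (fun j => integral_nonneg fun x => by positivity) heven hs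
  · exact Summable.of_nonneg_of_le (fun j => integral_nonneg fun x => by positivity) hodd
      (hs.mul_right _)

/-- Absolute summability allows the exponential series to be integrated term by term for every `t`,
so the moments determine the characteristic function. -/
theorem charFun_eq_tsum {μ : Measure ℝ} (hint : ∀ k : ℕ, Integrable (fun x => x ^ k) μ)
    (hbound : ∀ j : ℕ, ∫ x, x ^ (2 * j) ∂μ ≤ 4 ^ j * Nat.doubleFactorial (2 * j - 1)) (t : ℝ) :
    charFun μ t = ∑' k : ℕ, (t * Complex.I) ^ k / k.factorial * ((∫ x, x ^ k ∂μ : ℝ) : ℂ) := by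
  have e : ∀ (k : ℕ) (x : ℝ), (t * x * Complex.I) ^ k / (k.factorial : ℂ) =
      (t * Complex.I) ^ k / k.factorial * ((x ^ k : ℝ) : ℂ) := by
    intro k x
    push_cast
    rw [mul_right_comm, mul_pow]
    ring
  have hF : ∀ k : ℕ, Integrable (fun x : ℝ => (t * x * Complex.I) ^ k / (k.factorial : ℂ)) μ := by
    intro k
    simp only [e]
    exact (hint k).ofReal.const_mul _
  have hnorm : ∀ (k : ℕ) (x : ℝ), ‖(t * x * Complex.I) ^ k / (k.factorial : ℂ)‖ =
      |t * x| ^ k / k.factorial := by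
    intro k x
    simp [abs_mul]
  have h := hasSum_integral_of_summable_integral_norm hF
    (by simpa only [hnorm] using summable_integral_abs_pow hint hbound t)
  rw [charFun_apply_real]
  have hexp : ∀ x : ℝ, ∑' k : ℕ, (t * x * Complex.I) ^ k / (k.factorial : ℂ) =
      Complex.exp (t * x * Complex.I) := by
    intro x
    rw [Complex.exp_eq_exp_ℂ, NormedSpace.exp_eq_tsum_div]
  simp only [hexp] at h
  rw [← h.tsum_eq]
  refine tsum_congr fun k => ?_
  simp only [e]
  rw [integral_const_mul]
  exact congrArg _ integral_ofReal

/-- Two probability measures with the same moments, which grow at most like those of a Gaussian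
measure, are equal. -/
theorem probabilityMeasure_ext_of_moments {μ ν : ProbabilityMeasure ℝ} {m : ℕ → ℝ}
    (hm : ∀ j : ℕ, m (2 * j) ≤ 4 ^ j * Nat.doubleFactorial (2 * j - 1))
    (hμ : ∀ k : ℕ, Integrable (fun x : ℝ => x ^ k) (μ : Measure ℝ) ∧
      ∫ x, x ^ k ∂(μ : Measure ℝ) = m k)
    (hν : ∀ k : ℕ, Integrable (fun x : ℝ => x ^ k) (ν : Measure ℝ) ∧
      ∫ x, x ^ k ∂(ν : Measure ℝ) = m k) : μ = ν := by
  suffices (μ : Measure ℝ) = (ν : Measure ℝ) from Subtype.ext this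
  refine Measure.ext_of_charFun (funext fun t => ?_)
  rw [charFun_eq_tsum (fun k => (hμ k).1) (fun j => (hμ _).2.trans_le (hm j)),
    charFun_eq_tsum (fun k => (hν k).1) (fun j => (hν _).2.trans_le (hm j))]
  simp only [(hμ _).2, (hν _).2]

variable {ι : Type*} {F : Filter ι} {ν : ι → ProbabilityMeasure ℝ} {μ : ProbabilityMeasure ℝ}
  {m : ℕ → ℝ}

/-- Weak convergence bounds the integrals of the truncations `min (x^(2k)) M`; Fatou's lemma removes
the truncation. -/
theorem integrable_pow_and_integral_le_of_tendsto [F.NeBot] (hν : Tendsto ν F (𝓝 μ)) {k : ℕ} {C : ℝ}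
    (hint : ∀ i, Integrable (fun x : ℝ => x ^ (2 * k)) (ν i : Measure ℝ))
    (hC : ∀ᶠ i in F, ∫ x, x ^ (2 * k) ∂(ν i : Measure ℝ) ≤ C) :
    Integrable (fun x : ℝ => x ^ (2 * k)) (μ : Measure ℝ) ∧
      ∫ x, x ^ (2 * k) ∂(μ : Measure ℝ) ≤ C := by
  have hnn : ∀ x : ℝ, 0 ≤ x ^ (2 * k) := fun x => by rw [pow_mul]; positivity
  let g : ℕ → BoundedContinuousFunction ℝ ℝ := fun M =>
    BoundedContinuousFunction.ofNormedAddCommGroup (fun x => min (x ^ (2 * k)) M) (by fun_prop) M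
      (fun x => by
        rw [Real.norm_eq_abs, abs_of_nonneg (le_min (hnn x) (Nat.cast_nonneg M))]
        exact min_le_right _ _)
  have hgnn : ∀ M x, 0 ≤ g M x := fun M x => le_min (hnn x) (Nat.cast_nonneg M)
  have hg : ∀ M, ∫ x, g M x ∂(μ : Measure ℝ) ≤ C := by
    intro M
    refine le_of_tendsto (ProbabilityMeasure.tendsto_iff_forall_integral_tendsto.1 hν (g M)) ?_
    filter_upwards [hC] with i hi
    refine (integral_mono ((g M).integrable _) (hint i) fun x => ?_).trans hi
    exact min_le_left _ _
  have hC0 : 0 ≤ C := (integral_nonneg fun x => hgnn 0 x).trans (hg 0)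
  have hlim : ∫⁻ x, ENNReal.ofReal (x ^ (2 * k)) ∂(μ : Measure ℝ) ≤ ENNReal.ofReal C := by
    have h1 : ∀ x : ℝ, liminf (fun M : ℕ => ENNReal.ofReal (g M x)) atTop =
        ENNReal.ofReal (x ^ (2 * k)) := by
      intro x
      refine Tendsto.liminf_eq ((tendsto_const_nhds).congr' ?_)
      obtain ⟨N, hN⟩ := exists_nat_ge (x ^ (2 * k))
      filter_upwards [eventually_ge_atTop N] with M hM
      have : x ^ (2 * k) ≤ (M : ℝ) := hN.trans (Nat.cast_le.2 hM)
      change _ = ENNReal.ofReal (min _ _)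
      rw [min_eq_left this]
    simp only [← h1]
    refine (lintegral_liminf_le fun M => (g M).continuous.measurable.ennreal_ofReal).trans ?_
    refine liminf_le_of_le (by isBoundedDefault) fun b hb => ?_
    obtain ⟨M, hM⟩ := hb.exists
    refine hM.trans ?_
    rw [← ofReal_integral_eq_lintegral_ofReal ((g M).integrable _)
      (Eventually.of_forall (hgnn M))]
    exact ENNReal.ofReal_le_ofReal (hg M)
  have hI : Integrable (fun x : ℝ => x ^ (2 * k)) (μ : Measure ℝ) := by
    refine ⟨by fun_prop, ?_⟩
    rw [hasFiniteIntegral_iff_ofReal (Eventually.of_forall hnn)]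
    exact hlim.trans_lt ENNReal.ofReal_lt_top
  refine ⟨hI, ?_⟩
  rw [← ofReal_integral_eq_lintegral_ofReal hI (Eventually.of_forall hnn)] at hlim
  exact (ENNReal.ofReal_le_ofReal_iff hC0).1 hlim

theorem integrable_pow_of_even {μ : Measure ℝ} [IsFiniteMeasure μ] {k : ℕ}
    (h : Integrable (fun x : ℝ => x ^ (2 * k)) μ) : Integrable (fun x : ℝ => x ^ k) μ := by
  refine Integrable.mono' ((integrable_const (1 : ℝ)).add h) (by fun_prop)
    (Eventually.of_forall fun x => ?_)
  simp only [norm_pow, Real.norm_eq_abs, Pi.add_apply]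
  rw [mul_comm 2 k, pow_mul, ← sq_abs, abs_pow]
  nlinarith [sq_nonneg (|x| ^ k - 1), pow_nonneg (abs_nonneg x) k]

/-- A bounded continuous truncation of `x ↦ x ^ k`. -/
noncomputable def truncatedPow (k : ℕ) (M : ℝ) (hM : 0 ≤ M) : BoundedContinuousFunction ℝ ℝ :=
  BoundedContinuousFunction.ofNormedAddCommGroup (fun x => max (-M) (min (x ^ k) M))
    (by fun_prop) M (fun x => by
      rw [Real.norm_eq_abs, abs_le]
      exact ⟨le_max_left _ _, max_le (by linarith) (min_le_right _ _)⟩)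

theorem abs_pow_sub_truncatedPow_le (k : ℕ) {M : ℝ} (hM : 0 < M) (x : ℝ) :
    |x ^ k - truncatedPow k M hM.le x| ≤ x ^ (2 * k) / M := by
  change |x ^ k - max (-M) (min (x ^ k) M)| ≤ _
  rw [mul_comm 2 k, pow_mul, le_div_iff₀ hM]
  set y := x ^ k
  rcases le_total y M with h1 | h1
  · rcases le_total (-M) y with h2 | h2
    · rw [min_eq_left h1, max_eq_right h2, sub_self, abs_zero, zero_mul]
      positivity
    · rw [min_eq_left h1, max_eq_left h2, abs_of_nonpos (by linarith)]
      nlinarith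
  · rw [min_eq_right h1, max_eq_right (by linarith), abs_of_nonneg (by linarith)]
    nlinarith

theorem abs_integral_pow_sub_truncatedPow_le {μ : Measure ℝ} [IsFiniteMeasure μ] {k : ℕ} {C : ℝ}
    (h : Integrable (fun x : ℝ => x ^ (2 * k)) μ) (hC : ∫ x, x ^ (2 * k) ∂μ ≤ C) {M : ℝ}
    (hM : 0 < M) :
    |∫ x, x ^ k ∂μ - ∫ x, truncatedPow k M hM.le x ∂μ| ≤ C / M := by
  rw [← integral_sub (integrable_pow_of_even h) ((truncatedPow k M hM.le).integrable _)]
  refine (abs_integral_le_integral_abs).trans ?_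
  refine (integral_mono ((integrable_pow_of_even h).sub
    ((truncatedPow k M hM.le).integrable _)).abs (h.div_const M)
    (abs_pow_sub_truncatedPow_le k hM)).trans ?_
  rw [integral_div]
  exact div_le_div_of_nonneg_right hC hM.le

/-- If moments converge along a weakly convergent family, then the limit has the limit moments. -/
theorem moments_of_tendsto [F.NeBot] (hν : Tendsto ν F (𝓝 μ))
    (hint : ∀ i (k : ℕ), Integrable (fun x : ℝ => x ^ k) (ν i : Measure ℝ))
    (hm : ∀ k : ℕ, Tendsto (fun i => ∫ x, x ^ k ∂(ν i : Measure ℝ)) F (𝓝 (m k))) (k : ℕ) :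
    Integrable (fun x : ℝ => x ^ k) (μ : Measure ℝ) ∧ ∫ x, x ^ k ∂(μ : Measure ℝ) = m k := by
  set C := m (2 * k) + 1
  have hC : ∀ᶠ i in F, ∫ x, x ^ (2 * k) ∂(ν i : Measure ℝ) ≤ C :=
    ((hm (2 * k)).eventually (gt_mem_nhds (lt_add_one _))).mono fun i hi => hi.le
  obtain ⟨hI, hIC⟩ := integrable_pow_and_integral_le_of_tendsto hν (fun i => hint i _) hC
  refine ⟨integrable_pow_of_even hI, ?_⟩
  -- Truncating at level `M` costs `C / M` for the limit measure and `C / M` uniformly along the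
  -- family; the truncated integrals converge.
  have hbound : ∀ M : ℝ, 0 < M → |∫ x, x ^ k ∂(μ : Measure ℝ) - m k| ≤ 2 * C / M := by
    intro M hM
    have h1 := abs_integral_pow_sub_truncatedPow_le hI hIC hM
    have h2 := ProbabilityMeasure.tendsto_iff_forall_integral_tendsto.1 hν
      (truncatedPow k M hM.le)
    have h3 : Tendsto (fun i => |∫ x, x ^ k ∂(ν i : Measure ℝ) -
        ∫ x, truncatedPow k M hM.le x ∂(ν i : Measure ℝ)|) F
        (𝓝 |m k - ∫ x, truncatedPow k M hM.le x ∂(μ : Measure ℝ)|) := ((hm k).sub h2).abs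
    have h4 : |m k - ∫ x, truncatedPow k M hM.le x ∂(μ : Measure ℝ)| ≤ C / M := by
      refine le_of_tendsto h3 ?_
      filter_upwards [hC] with i hi
      exact abs_integral_pow_sub_truncatedPow_le (hint i _) hi hM
    have h5 := abs_sub_le (∫ x, x ^ k ∂(μ : Measure ℝ))
      (∫ x, truncatedPow k M hM.le x ∂(μ : Measure ℝ)) (m k)
    rw [abs_sub_comm (∫ x, truncatedPow k M hM.le x ∂(μ : Measure ℝ))] at h5
    rw [two_mul, add_div]
    linarith
  have hz : |∫ x, x ^ k ∂(μ : Measure ℝ) - m k| ≤ 0 := by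
    have hlim : Tendsto (fun M : ℝ => 2 * C / M) atTop (𝓝 0) :=
      tendsto_const_nhds.div_atTop tendsto_id
    refine ge_of_tendsto hlim ?_
    filter_upwards [eventually_gt_atTop 0] with M hM using hbound M hM
  exact sub_eq_zero.1 (abs_nonpos_iff.1 hz)

/-- Chebyshev's inequality bounds the mass outside `[-r, r]` by `C / r²`. -/
theorem isTightMeasureSet_of_second_moment {ν : ℕ → ProbabilityMeasure ℝ} {C : ℝ}
    (hint : ∀ n, Integrable (fun x : ℝ => x ^ 2) (ν n : Measure ℝ))
    (hC : ∀ n, ∫ x, x ^ 2 ∂(ν n : Measure ℝ) ≤ C) :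
    IsTightMeasureSet {((μ : ProbabilityMeasure ℝ) : Measure ℝ) | μ ∈ Set.range ν} := by
  refine isTightMeasureSet_of_tendsto_measure_norm_gt ?_
  have hlim : Tendsto (fun r : ℝ => ENNReal.ofReal (C / r ^ 2)) atTop (𝓝 0) := by
    rw [← ENNReal.ofReal_zero]
    exact ENNReal.tendsto_ofReal
      (tendsto_const_nhds.div_atTop (tendsto_pow_atTop two_ne_zero))
  refine tendsto_of_tendsto_of_tendsto_of_le_of_le' tendsto_const_nhds hlim
    (Eventually.of_forall fun _ => bot_le) ?_
  filter_upwards [eventually_gt_atTop 0] with r hr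
  refine iSup₂_le ?_
  rintro _ ⟨_, ⟨n, rfl⟩, rfl⟩
  have h1 := mul_meas_ge_le_integral_of_nonneg (μ := (ν n : Measure ℝ))
    (Eventually.of_forall fun x : ℝ => sq_nonneg x) (hint n) (r ^ 2)
  have hr2 : 0 < r ^ 2 := by positivity
  have h2 : (ν n : Measure ℝ).real {x | r ^ 2 ≤ x ^ 2} ≤ C / r ^ 2 := by
    rw [le_div_iff₀ hr2, mul_comm]
    exact h1.trans (hC n)
  have h3 : (ν n : Measure ℝ) {x | r < ‖x‖} ≤ (ν n : Measure ℝ) {x | r ^ 2 ≤ x ^ 2} := by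
    refine measure_mono fun x hx => ?_
    rw [Set.mem_ofPred_eq, ← sq_abs x]
    exact pow_le_pow_left₀ hr.le (le_of_lt hx) 2
  refine h3.trans ?_
  rw [← ofReal_measureReal]
  exact ENNReal.ofReal_le_ofReal h2

/-- By Prokhorov's theorem the sequence converges along every ultrafilter. Limits along ultrafilters
finer than `atTop` all have the moments `m`, and these determine the measure, so the limits
coincide. -/
theorem exists_tendsto_of_moments {ν : ℕ → ProbabilityMeasure ℝ}
    (hint : ∀ n (k : ℕ), Integrable (fun x : ℝ => x ^ k) (ν n : Measure ℝ))
    (hm : ∀ k : ℕ, Tendsto (fun n => ∫ x, x ^ k ∂(ν n : Measure ℝ)) atTop (𝓝 (m k)))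
    (hgrowth : ∀ j : ℕ, m (2 * j) ≤ 4 ^ j * Nat.doubleFactorial (2 * j - 1)) :
    ∃ μ : ProbabilityMeasure ℝ, Tendsto ν atTop (𝓝 μ) := by
  obtain ⟨C, hC⟩ := (hm 2).bddAbove_range
  have hcomp := isCompact_closure_of_isTightMeasureSet
    (isTightMeasureSet_of_second_moment (fun n => hint n 2) fun n => hC ⟨n, rfl⟩)
  have hU : ∀ U : Ultrafilter ℕ, ∃ μ, Tendsto ν U (𝓝 μ) := by
    intro U
    obtain ⟨μ, -, hμ⟩ := hcomp.ultrafilter_le_nhds (U.map ν)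
      (by
        rw [le_principal_iff]
        exact Filter.mem_of_superset (Filter.range_mem_map) subset_closure)
    exact ⟨μ, hμ⟩
  -- A single free ultrafilter supplies the candidate limit.
  obtain ⟨μ, hμ⟩ := hU (Filter.hyperfilter ℕ)
  have hle : ((Filter.hyperfilter ℕ : Ultrafilter ℕ) : Filter ℕ) ≤ atTop := Nat.hyperfilter_le_atTop
  refine ⟨μ, (tendsto_iff_ultrafilter _ _ _).2 fun U hUle => ?_⟩
  obtain ⟨μ', hμ'⟩ := hU U
  rwa [probabilityMeasure_ext_of_moments hgrowth
    (moments_of_tendsto hμ hint fun k => (hm k).mono_left hle)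
    (moments_of_tendsto hμ' hint fun k => (hm k).mono_left hUle)]

end Moments

/-! ### The limit law -/

section

variable {d : ℕ} {w : Fin d → ℝ} {H : Type*} [NormedAddCommGroup H] [InnerProductSpace ℂ H]
  {G : GNSRep w H} {A₀ : H →L[ℂ] H}

theorem norm_vec_one (G : GNSRep w H) : ‖G.vec 1‖ = 1 := by
  have h := G.inner_vec 1 1
  rw [inv_one, mul_one, character_one] at h
  have h2 : ‖G.vec 1‖ ^ 2 = 1 := by
    rw [← inner_self_eq_norm_sq (𝕜 := ℂ), h]
    simp
  exact (pow_eq_one_iff_of_nonneg (norm_nonneg _) two_ne_zero).1 h2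

theorem tendsto_moments_of_isLaw (hA : G.IsAverageLimit A₀) {ν : ℕ → ProbabilityMeasure ℝ}
    (hν : ∀ n, 1 ≤ n → IsLaw (G.rescaledAverage A₀ n) (G.vec 1) (ν n)) (k : ℕ) :
    Tendsto (fun n => ∫ x, x ^ k ∂(ν (n + 1) : Measure ℝ)) atTop (𝓝 (limitMoment w k)) := by
  refine ((tendsto_add_atTop_iff_nat 1).2 (tendsto_rescaled_sum w k)).congr fun n => ?_
  have h := (hν (n + 1) (by omega)).2 k
  rw [inner_rescaledAverage_pow hA] at h
  exact (Complex.ofReal_injective h).symm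

theorem limitMoment_growth (hw_pos : ∀ i, 0 < w i) (hw_sum : ∑ i, w i = 1) (j : ℕ) :
    limitMoment w (2 * j) ≤ 4 ^ j * Nat.doubleFactorial (2 * j - 1) :=
  (le_abs_self _).trans (abs_limitMoment_le hw_pos hw_sum j)

/-- The moments do not involve the chosen realization, which is what makes the limit law unique. The
shift to `n + 1` skips `n = 0`, where nothing is assumed about the law. -/
theorem IsLimitLaw.moments {μ : ProbabilityMeasure ℝ} (hμ : IsLimitLaw w μ) (k : ℕ) :
    Integrable (fun t : ℝ => t ^ k) (μ : Measure ℝ) ∧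
      ∫ t, t ^ k ∂(μ : Measure ℝ) = limitMoment w k := by
  obtain ⟨H, _, _, _, G, A₀, ν, hA, hν, hlim⟩ := hμ
  exact moments_of_tendsto ((tendsto_add_atTop_iff_nat 1).2 hlim)
    (fun n k => (hν (n + 1) (by omega)).integrable_pow k) (tendsto_moments_of_isLaw hA hν) k

theorem exists_isLimitLaw (hw_pos : ∀ i, 0 < w i) (hw_sum : ∑ i, w i = 1) :
    ∃ μ : ProbabilityMeasure ℝ, IsLimitLaw w μ := by
  obtain ⟨H, _, _, _, ⟨G⟩⟩ := exists_gnsRep hw_pos hw_sum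
  obtain ⟨A₀, hA⟩ := exists_isAverageLimit G
  choose ν hν using fun n => exists_isLaw (rescaledAverage_isSymmetric hA n) (norm_vec_one G)
  obtain ⟨μ, hμ⟩ := exists_tendsto_of_moments (ν := fun n => ν (n + 1))
    (fun n k => (hν (n + 1)).integrable_pow k)
    (tendsto_moments_of_isLaw hA fun n _ => hν n) (limitMoment_growth hw_pos hw_sum)
  exact ⟨μ, H, _, _, ‹_›, G, A₀, ν, hA, fun n _ => hν n, (tendsto_add_atTop_iff_nat 1).1 hμ⟩

end

end StarCLT

theorem proposition5p6 {d : ℕ} (hd : 2 ≤ d) (w : Fin d → ℝ) (hw_anti : Antitone w)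
    (hw_pos : ∀ i, 0 < w i) (hw_sum : ∑ i, w i = 1) :
    (∃! μ : ProbabilityMeasure ℝ, StarCLT.IsLimitLaw w μ) ∧
    ∀ μ : ProbabilityMeasure ℝ, StarCLT.IsLimitLaw w μ →
      ∀ k : ℕ, 0 < k → Even k →
        Integrable (fun t : ℝ => t ^ k) (μ : Measure ℝ) ∧
        ∫ t, t ^ k ∂(μ : Measure ℝ) =
          ∑ π ∈ StarCLT.partitionsLeTwo k,
            (-1 : ℝ) ^ (StarCLT.numSingletons π / 2) *
              (Nat.doubleFactorial (StarCLT.numSingletons π - 1) : ℝ) *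
              StarCLT.character w (StarCLT.tau π) := by
  refine ⟨?_, fun μ hμ k _ hk => ?_⟩
  · obtain ⟨μ, hμ⟩ := StarCLT.exists_isLimitLaw hw_pos hw_sum
    exact ⟨μ, hμ, fun ν hν => StarCLT.probabilityMeasure_ext_of_moments
      (StarCLT.limitMoment_growth hw_pos hw_sum) hν.moments hμ.moments⟩
  · rw [← StarCLT.limitMoment_eq w hk]
    exact hμ.moments k
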